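/- For a measure space $(\Omega,\Sigma,\mu)$ and $1<p<\infty$, let $q=p/(p-1)$ and let $L^{p,\infty}(\Omega,\Sigma,\mu)$ be the real vector space of all $\Sigma$-measurable functions $f:\Omega\to\mathbb{R}$ (modulo equality $\mu$-almost everywhere) such that $\{\omega : |f(\omega)|>0\}$ is $\sigma$-finite and \[ \|f\| = \sup_B \frac{\int_B |f|\,d\mu}{\mu(B)^{1/q}} < \infty, \] where the supremum is taken over all measurable sets $B$ with $0<\mu(B)<\infty$; it is normed by $\|\cdot\|$. Write $\ell^{p,\infty}$ for this space on $\mathbb{N}$ with the counting measure, and $L^{p,\infty}[0,1]$, $L^{p,\infty}[0,\infty)$ for this space on $[0,1]$ and $[0,\infty)$ with Lebesgue measure. Theorem. For every $1<p<\infty$, the spaces $\ell^{p,\infty}$, $L^{p,\infty}[0,1]$ and $L^{p,\infty}[0,\infty)$ are Banach spaces and are pairwise isomorphic as Banach spaces, that is, between any two of them there is a linear bijection which is continuous with continuous inverse. -/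

import Mathlib

open MeasureTheory
open scoped ENNReal

/-- The weak `L^p` norm of `f`, as an extended nonnegative number: the supremum of
`(∫_B |f| dμ) / μ(B)^{1/q}`, `q = p / (p - 1)`, over all measurable sets `B` with
`0 < μ(B) < ∞`. -/
noncomputable def weakLpENorm {Ω : Type*} [MeasurableSpace Ω] (p : ℝ) (μ : Measure Ω)
    (f : Ω → ℝ) : ℝ≥0∞ :=
  ⨆ (B : Set Ω) (_ : MeasurableSet B) (_ : 0 < μ B) (_ : μ B < ∞),
    (∫⁻ x in B, ‖f x‖ₑ ∂μ) / μ B ^ (1 / Real.conjExponent p)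

theorem weakLpENorm_congr {Ω : Type*} [MeasurableSpace Ω] {p : ℝ} {μ : Measure Ω}
    {f g : Ω → ℝ} (h : f =ᵐ[μ] g) : weakLpENorm p μ f = weakLpENorm p μ g := by
  unfold weakLpENorm
  refine iSup_congr fun B => iSup_congr fun _ => iSup_congr fun _ => iSup_congr fun _ => ?_
  congr 1
  refine lintegral_congr_ae (ae_restrict_of_ae ?_)
  filter_upwards [h] with x hx
  rw [hx]

theorem weakLpENorm_add_le {Ω : Type*} [MeasurableSpace Ω] {p : ℝ} {μ : Measure Ω}
    {f g : Ω → ℝ} (hf : AEMeasurable f μ) :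
    weakLpENorm p μ (f + g) ≤ weakLpENorm p μ f + weakLpENorm p μ g := by
  refine iSup_le fun B => iSup_le fun hB => iSup_le fun h0 => iSup_le fun h1 => ?_
  calc (∫⁻ x in B, ‖(f + g) x‖ₑ ∂μ) / μ B ^ (1 / Real.conjExponent p)
      ≤ (∫⁻ x in B, (‖f x‖ₑ + ‖g x‖ₑ) ∂μ) / μ B ^ (1 / Real.conjExponent p) := by
        gcongr with x
        exact enorm_add_le _ _
    _ = (∫⁻ x in B, ‖f x‖ₑ ∂μ) / μ B ^ (1 / Real.conjExponent p)
        + (∫⁻ x in B, ‖g x‖ₑ ∂μ) / μ B ^ (1 / Real.conjExponent p) := by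
        rw [lintegral_add_left' hf.enorm.restrict, ENNReal.add_div]
    _ ≤ _ := by
        gcongr
        · exact le_iSup₂_of_le B hB (le_iSup₂_of_le h0 h1 le_rfl)
        · exact le_iSup₂_of_le B hB (le_iSup₂_of_le h0 h1 le_rfl)

theorem weakLpENorm_const_smul {Ω : Type*} [MeasurableSpace Ω] {p : ℝ} {μ : Measure Ω}
    (c : ℝ) (f : Ω → ℝ) :
    weakLpENorm p μ (c • f) = ‖c‖ₑ * weakLpENorm p μ f := by
  unfold weakLpENorm
  simp only [ENNReal.mul_iSup]
  refine iSup_congr fun B => iSup_congr fun _ => iSup_congr fun _ => iSup_congr fun _ => ?_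
  rw [← mul_div_assoc, ← lintegral_const_mul' _ _ enorm_ne_top]
  simp [enorm_mul]

theorem ae_eq_zero_of_weakLpENorm_eq_zero {Ω : Type*} [MeasurableSpace Ω] {p : ℝ}
    {μ : Measure Ω} {f : Ω → ℝ} (hf : AEMeasurable f μ)
    (hs : SigmaFinite (μ.restrict (Function.support f))) (hm : MeasurableSet (Function.support f))
    (h : weakLpENorm p μ f = 0) : f =ᵐ[μ] 0 := by
  set S := Function.support f with hS
  have key : ∀ n, μ (spanningSets (μ.restrict S) n ∩ S) = 0 := by
    intro n
    by_contra hne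
    set B := spanningSets (μ.restrict S) n ∩ S with hB
    have hBm : MeasurableSet B := (measurableSet_spanningSets _ n).inter hm
    have hBt : μ B < ∞ := by
      have := measure_spanningSets_lt_top (μ.restrict S) n
      rwa [Measure.restrict_apply (measurableSet_spanningSets _ n)] at this
    have h1 : (∫⁻ x in B, ‖f x‖ₑ ∂μ) / μ B ^ (1 / Real.conjExponent p) = 0 := by
      refine le_antisymm (h ▸ ?_) zero_le
      exact le_iSup₂_of_le B hBm (le_iSup₂_of_le (pos_iff_ne_zero.2 hne) hBt le_rfl)
    rw [ENNReal.div_eq_zero_iff] at h1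
    have h2 := h1.resolve_right (ENNReal.rpow_ne_top_of_ne_zero hne hBt.ne)
    rw [lintegral_eq_zero_iff' hf.enorm.restrict] at h2
    apply hne
    have h3 : ∀ᵐ x ∂(μ.restrict B), x ∉ B := by
      filter_upwards [h2] with x hx hxB
      have hfx : f x ≠ 0 := hxB.2
      exact hfx (by simpa using hx)
    rw [ae_iff, Measure.restrict_apply' hBm] at h3
    simpa using h3
  have hU : μ S = 0 := by
    have : S = ⋃ n, spanningSets (μ.restrict S) n ∩ S := by
      rw [← Set.iUnion_inter, iUnion_spanningSets, Set.univ_inter]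
    rw [this]
    exact measure_iUnion_null key
  rw [Filter.EventuallyEq, ae_iff]
  exact hU

theorem sigmaFinite_restrict_of_ae_le {Ω : Type*} [MeasurableSpace Ω] {μ : Measure Ω}
    {s t : Set Ω} (hst : ∀ᵐ x ∂μ, x ∈ s → x ∈ t) (ht : SigmaFinite (μ.restrict t)) :
    SigmaFinite (μ.restrict s) :=
  Measure.sigmaFinite_of_le (μ.restrict t) (Measure.restrict_mono_ae hst)

/-- The weak `L^p` space `L^{p,∞}(Ω, Σ, μ)`: classes, modulo equality almost everywhere, of
measurable real functions `f` such that `{f ≠ 0}` is `σ`-finite and `‖f‖ < ∞`. -/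
noncomputable def WeakLp {Ω : Type*} [MeasurableSpace Ω] (p : ℝ) (μ : Measure Ω) :
    Submodule ℝ (Ω →ₘ[μ] ℝ) where
  carrier := {f | SigmaFinite (μ.restrict (Function.support f)) ∧ weakLpENorm p μ f < ∞}
  zero_mem' := by
    refine ⟨sigmaFinite_restrict_of_ae_le (t := ∅) ?_ ?_, ?_⟩
    · filter_upwards [AEEqFun.coeFn_zero (μ := μ) (β := ℝ)] with x hx hxs
      exact (hxs hx).elim
    · rw [Measure.restrict_empty]
      infer_instance
    · rw [weakLpENorm_congr AEEqFun.coeFn_zero]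
      simp [weakLpENorm]
  add_mem' := by
    rintro f g ⟨hf, hf'⟩ ⟨hg, hg'⟩
    refine ⟨sigmaFinite_restrict_of_ae_le
      (t := Function.support f ∪ Function.support g) ?_ inferInstance, ?_⟩
    · filter_upwards [AEEqFun.coeFn_add f g] with x hx hxs
      rw [Function.mem_support, hx] at hxs
      exact Function.support_add _ _ hxs
    · rw [weakLpENorm_congr (AEEqFun.coeFn_add f g)]
      exact (weakLpENorm_add_le f.aemeasurable).trans_lt (ENNReal.add_lt_top.2 ⟨hf', hg'⟩)
  smul_mem' := by
    rintro c f ⟨hf, hf'⟩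
    refine ⟨sigmaFinite_restrict_of_ae_le (t := Function.support f) ?_ hf, ?_⟩
    · filter_upwards [AEEqFun.coeFn_smul c f] with x hx hxs
      rw [Function.mem_support, hx] at hxs
      exact fun h0 => hxs (by simp [h0])
    · rw [weakLpENorm_congr (AEEqFun.coeFn_smul c f), weakLpENorm_const_smul]
      exact ENNReal.mul_lt_top enorm_lt_top hf'

noncomputable instance WeakLp.instNormedAddCommGroup {Ω : Type*} [MeasurableSpace Ω] (p : ℝ)
    (μ : Measure Ω) : NormedAddCommGroup (WeakLp p μ) :=
  AddGroupNorm.toNormedAddCommGroup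
    { toFun := fun f => (weakLpENorm p μ f.1).toReal
      map_zero' := by
        rw [Submodule.coe_zero, weakLpENorm_congr AEEqFun.coeFn_zero]
        simp [weakLpENorm]
      add_le' := fun f g => by
        rw [Submodule.coe_add, weakLpENorm_congr (AEEqFun.coeFn_add _ _),
          ← ENNReal.toReal_add f.2.2.ne g.2.2.ne]
        exact ENNReal.toReal_mono (ENNReal.add_ne_top.2 ⟨f.2.2.ne, g.2.2.ne⟩)
          (weakLpENorm_add_le f.1.aemeasurable)
      neg' := fun f => by
        rw [Submodule.coe_neg, weakLpENorm_congr (AEEqFun.coeFn_neg _)]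
        simp [weakLpENorm]
      eq_zero_of_map_eq_zero' := fun f hf => by
        have h0 : weakLpENorm p μ f.1 = 0 :=
          (ENNReal.toReal_eq_zero_iff _).1 hf |>.resolve_right f.2.2.ne
        refine Subtype.ext (AEEqFun.ext ?_)
        refine (ae_eq_zero_of_weakLpENorm_eq_zero f.1.aemeasurable f.2.1
          (f.1.measurable (measurableSet_singleton (0 : ℝ)).compl) h0).trans ?_
        exact AEEqFun.coeFn_zero.symm }

theorem WeakLp.norm_def {Ω : Type*} [MeasurableSpace Ω] {p : ℝ} {μ : Measure Ω}
    (f : WeakLp p μ) : ‖f‖ = (weakLpENorm p μ f.1).toReal := rfl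

noncomputable instance WeakLp.instNormedSpace {Ω : Type*} [MeasurableSpace Ω] (p : ℝ)
    (μ : Measure Ω) : NormedSpace ℝ (WeakLp p μ) where
  norm_smul_le c f := by
    rw [WeakLp.norm_def, WeakLp.norm_def, Submodule.coe_smul,
      weakLpENorm_congr (AEEqFun.coeFn_smul c f.1), weakLpENorm_const_smul, ENNReal.toReal_mul,
      toReal_enorm]

/-- The sequence space `ℓ^{p,∞}`. -/
noncomputable abbrev weakSeqLp (p : ℝ) : Submodule ℝ (ℕ →ₘ[Measure.count] ℝ) :=
  WeakLp p Measure.count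

/-- The space `L^{p,∞}(I)` for a set `I` of real numbers with Lebesgue measure. -/
noncomputable abbrev weakLpOn (p : ℝ) (I : Set ℝ) :
    Submodule ℝ (ℝ →ₘ[volume.restrict I] ℝ) :=
  WeakLp p (volume.restrict I)

/-! All three spaces are compared with the space Z of bounded sequences in L = L^{p,∞}[0,∞). Since Z
is isomorphic to the bounded sequences in Z, Pełczyński's decomposition method
(`nonempty_equiv_of_isComplementedIn`) reduces the theorem to complemented embeddings both ways. One
way is easy: ℓ^{p,∞} is the range of averaging over unit intervals, L^{p,∞}[0,1] is a restriction of
L, and L is a coordinate of Z.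

The other way places Z in ℓ^{p,∞} and in L^{p,∞}[0,1] (`isComplementedIn_boundedSeq_of_blocks`).
Block i = pair(n, m) takes coordinate m of the sequence, averages it over the first 4^i dyadic cells
of length s_i = 2^{-i}, and copies the values, times (s_i/d_i)^{1/p}, to 4^i disjoint cells of
measure d_i in the target. Up to constants, the weak norm is governed by the excess ∫(|f| - t)⁺ ≤ K
t^{1-p}, which decreases under averaging by Jensen and adds over blocks. With ‖f‖ ≤ C, cells with
d_i ≥ (C/t)^p never reach height t; of the remaining blocks, the one with the largest cells has
excess at most C^p t^{1-p}, and the total masses of the others sum to no more when the d_i are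
lacunary (`tsum_le_of_lacunary`). So all blocks together stay bounded.

The left inverse copies the blocks pair(n, m), n = 0, 1, ..., back and takes a weak limit along an
ultrafilter. On the image of a sequence this yields averages of coordinate m on ever finer grids,
which converge weakly to that coordinate. Weak limits exist because the norm bound gives uniform
absolute continuity, so Radon–Nikodym applies (`exists_tendsto_setLIntegral`). The same limits prove
completeness. -/

/-! ### The weak norm and the excess integrals ∫(|f| - t)⁺. -/

section Estimates

variable {Ω : Type*} [MeasurableSpace Ω] {p : ℝ} {μ : Measure Ω} {f : Ω → ℝ}

theorem one_div_conjExponent (hp : 1 < p) : 1 / Real.conjExponent p = 1 - 1 / p := by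
  have h0 : p ≠ 0 := by linarith
  have h1 : p - 1 ≠ 0 := by linarith
  unfold Real.conjExponent
  field_simp

theorem one_sub_one_div_pos (hp : 1 < p) : 0 < 1 - 1 / p := by
  have : 1 / p < 1 := by rw [div_lt_one] <;> linarith
  linarith

theorem setLIntegral_enorm_le_weakLpENorm_mul (hp : 1 < p) {B : Set Ω} (hB : MeasurableSet B)
    (hB' : μ B < ∞) :
    ∫⁻ x in B, ‖f x‖ₑ ∂μ ≤ weakLpENorm p μ f * μ B ^ (1 - 1 / p) := by
  rcases eq_or_ne (μ B) 0 with h0 | h0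
  · rw [Measure.restrict_eq_zero.2 h0]
    simp
  · rw [← one_div_conjExponent hp, ← ENNReal.div_le_iff_le_mul]
    · exact le_iSup₂_of_le B hB (le_iSup₂_of_le (pos_iff_ne_zero.2 h0) hB' le_rfl)
    · exact Or.inl (by simp [ENNReal.rpow_eq_zero_iff, h0, hB'.ne])
    · exact Or.inl (ENNReal.rpow_ne_top_of_ne_zero h0 hB'.ne)

theorem weakLpENorm_le_of_forall (hp : 1 < p) {C : ℝ≥0∞}
    (h : ∀ B, MeasurableSet B → 0 < μ B → μ B < ∞ →
      ∫⁻ x in B, ‖f x‖ₑ ∂μ ≤ C * μ B ^ (1 - 1 / p)) : weakLpENorm p μ f ≤ C := by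
  refine iSup_le fun B => iSup_le fun hB => iSup_le fun h0 => iSup_le fun h1 => ?_
  rw [one_div_conjExponent hp]
  exact ENNReal.div_le_of_le_mul (h B hB h0 h1)

theorem integrableOn_of_weakLpENorm_lt_top (hp : 1 < p) (hf : AEStronglyMeasurable f μ)
    (hf' : weakLpENorm p μ f < ∞) {B : Set Ω} (hB : MeasurableSet B) (hB' : μ B < ∞) :
    IntegrableOn f B μ := by
  refine ⟨hf.restrict, ?_⟩
  refine (setLIntegral_enorm_le_weakLpENorm_mul hp hB hB').trans_lt ?_
  exact ENNReal.mul_lt_top hf' (ENNReal.rpow_lt_top_of_nonneg (one_sub_one_div_pos hp).le hB'.ne)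

theorem setIntegral_abs_le_of_weakLpENorm_le (hp : 1 < p) {C : ℝ} (hC : 0 ≤ C)
    (hf : AEStronglyMeasurable f μ)
    (hfC : weakLpENorm p μ f ≤ ENNReal.ofReal C) {B : Set Ω} (hB : MeasurableSet B)
    (hB' : μ B < ∞) : ∫ x in B, |f x| ∂μ ≤ C * μ.real B ^ (1 - 1 / p) := by
  have h := setLIntegral_enorm_le_weakLpENorm_mul (f := f) hp hB hB'
  have h2 : ∫⁻ x in B, ‖f x‖ₑ ∂μ ≤ ENNReal.ofReal (C * μ.real B ^ (1 - 1 / p)) := by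
    refine h.trans ?_
    rw [ENNReal.ofReal_mul hC, ← ENNReal.ofReal_rpow_of_nonneg measureReal_nonneg
      (one_sub_one_div_pos hp).le, ofReal_measureReal hB'.ne]
    gcongr
  rw [show (fun x => |f x|) = fun x => ‖f x‖ from rfl, integral_norm_eq_lintegral_enorm hf.restrict]
  exact ENNReal.toReal_le_of_le_ofReal (by positivity) h2

/-- Chebyshev: t r ≤ ∫_B |f| ≤ C r^{1-1/p} for r = μ(B), to be solved for r. The norm tests only
sets of finite measure, so the superlevel set is first cut by the spanning sets. -/
theorem measure_superlevel_le (hp : 1 < p) [SigmaFinite μ] (hf : Measurable f) {C t : ℝ}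
    (hC : 0 ≤ C) (ht : 0 < t) (hfC : weakLpENorm p μ f ≤ ENNReal.ofReal C) :
    μ {x | t < |f x|} ≤ ENNReal.ofReal ((C / t) ^ p) := by
  have hp0 : 0 < p := by linarith
  have hSm : MeasurableSet {x | t < |f x|} := measurableSet_lt measurable_const hf.abs
  rw [← Measure.iSup_restrict_spanningSets]
  refine iSup_le fun n => ?_
  rw [Measure.restrict_apply hSm]
  set B := {x | t < |f x|} ∩ spanningSets μ n with hBdef
  have hBm : MeasurableSet B := hSm.inter (measurableSet_spanningSets μ n)
  have hBt : μ B < ∞ := (measure_mono Set.inter_subset_right).trans_lt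
    (measure_spanningSets_lt_top μ n)
  have h1 := setIntegral_abs_le_of_weakLpENorm_le hp hC hf.aestronglyMeasurable hfC hBm hBt
  have h2 : t * μ.real B ≤ ∫ x in B, |f x| ∂μ := by
    refine setIntegral_ge_of_const_le_real hBm hBt.ne (fun x hx => hx.1.le) ?_
    exact (integrableOn_of_weakLpENorm_lt_top hp hf.aestronglyMeasurable
      (hfC.trans_lt ENNReal.ofReal_lt_top) hBm hBt).abs
  have h3 := h2.trans h1
  rw [← ofReal_measureReal hBt.ne]
  apply ENNReal.ofReal_le_ofReal
  rcases (measureReal_nonneg (μ := μ) (s := B)).eq_or_lt with h0 | h0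
  · rw [← h0]; positivity
  set r := μ.real B
  have h4 : r ^ (1 / p) ≤ C / t := by
    rw [le_div_iff₀ ht]
    have h5 : r = r ^ (1 / p) * r ^ (1 - 1 / p) := by
      rw [← Real.rpow_add h0]; simp
    have h6 : 0 < r ^ (1 - 1 / p) := by positivity
    refine le_of_mul_le_mul_right ?_ h6
    calc r ^ (1 / p) * t * r ^ (1 - 1 / p) = t * (r ^ (1 / p) * r ^ (1 - 1 / p)) := by ring
      _ = t * r := by rw [← h5]
      _ ≤ _ := h3
  calc r = (r ^ (1 / p)) ^ p := by
        rw [← Real.rpow_mul h0.le, one_div, inv_mul_cancel₀ hp0.ne', Real.rpow_one]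
    _ ≤ _ := Real.rpow_le_rpow (by positivity) h4 hp0.le

theorem lintegral_excess_le (hp : 1 < p) [SigmaFinite μ] (hf : Measurable f) {C t : ℝ}
    (hC : 0 < C) (ht : 0 < t) (hfC : weakLpENorm p μ f ≤ ENNReal.ofReal C) :
    ∫⁻ x, ENNReal.ofReal (|f x| - t) ∂μ ≤ ENNReal.ofReal (C ^ p * t ^ (1 - p)) := by
  have hp0 : 0 < p := by linarith
  have hSm : MeasurableSet {x | t < |f x|} := measurableSet_lt measurable_const hf.abs
  have h1 := measure_superlevel_le hp hf hC.le ht hfC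
  calc ∫⁻ x, ENNReal.ofReal (|f x| - t) ∂μ
      = ∫⁻ x in {x | t < |f x|}, ENNReal.ofReal (|f x| - t) ∂μ := by
        rw [← lintegral_indicator hSm]
        refine lintegral_congr fun x => ?_
        by_cases h : t < |f x|
        · rw [Set.indicator_of_mem (show x ∈ {x | t < |f x|} from h)]
        · rw [Set.indicator_of_notMem (show x ∉ {x | t < |f x|} from h)]
          exact ENNReal.ofReal_of_nonpos (by linarith)
    _ ≤ ∫⁻ x in {x | t < |f x|}, ‖f x‖ₑ ∂μ := by
        refine lintegral_mono fun x => ?_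
        rw [← ofReal_norm, Real.norm_eq_abs]
        exact ENNReal.ofReal_le_ofReal (by linarith)
    _ ≤ weakLpENorm p μ f * μ {x | t < |f x|} ^ (1 - 1 / p) :=
        setLIntegral_enorm_le_weakLpENorm_mul hp hSm (h1.trans_lt ENNReal.ofReal_lt_top)
    _ ≤ ENNReal.ofReal C * ENNReal.ofReal ((C / t) ^ p) ^ (1 - 1 / p) := by
        have := (one_sub_one_div_pos hp).le
        gcongr
    _ = ENNReal.ofReal (C ^ p * t ^ (1 - p)) := by
        rw [ENNReal.ofReal_rpow_of_nonneg (by positivity) (one_sub_one_div_pos hp).le,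
          ← ENNReal.ofReal_mul hC.le]
        congr 1
        rw [← Real.rpow_mul (by positivity), show p * (1 - 1 / p) = p - 1 by field_simp,
          Real.div_rpow hC.le ht.le, show (1 - p) = -(p - 1) by ring, Real.rpow_neg ht.le,
          ← div_eq_mul_inv, ← mul_div_assoc]
        congr 1
        nth_rw 1 [← Real.rpow_one C]
        rw [← Real.rpow_add hC]
        congr 1; ring

/-- Converse of `lintegral_excess_le` up to a factor 2: on B, |f| ≤ t + (|f| - t)⁺. Boundedness of
operators is checked through this criterion because excesses add over disjoint pieces. -/
theorem weakLpENorm_le_of_lintegral_excess_le (hp : 1 < p) {K : ℝ} (hK : 0 < K)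
    (h : ∀ t : ℝ, 0 < t →
      ∫⁻ x, ENNReal.ofReal (|f x| - t) ∂μ ≤ ENNReal.ofReal (K * t ^ (1 - p))) :
    weakLpENorm p μ f ≤ ENNReal.ofReal (2 * K ^ (1 / p)) := by
  have hp0 : 0 < p := by linarith
  refine weakLpENorm_le_of_forall hp fun B hB h0 h1 => ?_
  set r := μ.real B with hr
  have hr0 : 0 < r := ENNReal.toReal_pos h0.ne' h1.ne
  have hBr : μ B = ENNReal.ofReal r := (ofReal_measureReal h1.ne).symm
  -- The height at which the two contributions t r and K t^{1-p} are equal; their sum gives the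
  -- factor 2.
  set t := K ^ (1 / p) * r ^ (-(1 / p)) with ht
  have ht0 : 0 < t := by positivity
  have e1 : t * r = K ^ (1 / p) * r ^ (1 - 1 / p) := by
    rw [ht, mul_assoc]
    congr 1
    nth_rw 2 [← Real.rpow_one r]
    rw [← Real.rpow_add hr0]
    congr 1; ring
  have e2 : K * t ^ (1 - p) = K ^ (1 / p) * r ^ (1 - 1 / p) := by
    rw [ht, Real.mul_rpow (by positivity) (by positivity), ← Real.rpow_mul hK.le,
      ← Real.rpow_mul hr0.le, ← mul_assoc]
    congr 1
    · nth_rw 1 [← Real.rpow_one K]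
      rw [← Real.rpow_add hK]
      congr 1
      field_simp; ring
    · congr 1
      field_simp; ring
  calc ∫⁻ x in B, ‖f x‖ₑ ∂μ
      ≤ ∫⁻ x in B, (ENNReal.ofReal t + ENNReal.ofReal (|f x| - t)) ∂μ := by
        refine lintegral_mono fun x => ?_
        rw [← ofReal_norm, Real.norm_eq_abs]
        refine le_trans ?_ ENNReal.ofReal_add_le
        exact ENNReal.ofReal_le_ofReal (by linarith)
    _ = ENNReal.ofReal t * μ B + ∫⁻ x in B, ENNReal.ofReal (|f x| - t) ∂μ := by
        rw [lintegral_add_left measurable_const, setLIntegral_const]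
    _ ≤ ENNReal.ofReal t * μ B + ENNReal.ofReal (K * t ^ (1 - p)) := by
        gcongr
        exact (setLIntegral_le_lintegral _ _).trans (h t ht0)
    _ = ENNReal.ofReal (2 * K ^ (1 / p)) * μ B ^ (1 - 1 / p) := by
        rw [hBr, ← ENNReal.ofReal_mul ht0.le, ENNReal.ofReal_rpow_of_pos hr0,
          ← ENNReal.ofReal_add (by positivity) (by positivity),
          ← ENNReal.ofReal_mul (by positivity), e1, e2]
        congr 1; ring

end Estimates

/-! ### Elements of the space and bounded operators into it. -/

namespace WeakLp

variable {Ω : Type*} [MeasurableSpace Ω] {p : ℝ} {μ : Measure Ω}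

theorem weakLpENorm_eq_ofReal_norm (f : WeakLp p μ) :
    weakLpENorm p μ f.1 = ENNReal.ofReal ‖f‖ := by
  rw [norm_def, ENNReal.ofReal_toReal f.2.2.ne]

theorem norm_le_of_weakLpENorm_le {f : WeakLp p μ} {C : ℝ} (hC : 0 ≤ C)
    (h : weakLpENorm p μ f.1 ≤ ENNReal.ofReal C) : ‖f‖ ≤ C :=
  ENNReal.toReal_le_of_le_ofReal hC h

theorem integrableOn (hp : 1 < p) (f : WeakLp p μ) {B : Set Ω} (hB : MeasurableSet B)
    (hB' : μ B < ∞) : IntegrableOn f.1 B μ :=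
  integrableOn_of_weakLpENorm_lt_top hp f.1.aestronglyMeasurable f.2.2 hB hB'

theorem setIntegral_abs_le (hp : 1 < p) (f : WeakLp p μ) {B : Set Ω} (hB : MeasurableSet B)
    (hB' : μ B < ∞) : ∫ x in B, |f.1 x| ∂μ ≤ ‖f‖ * μ.real B ^ (1 - 1 / p) :=
  setIntegral_abs_le_of_weakLpENorm_le hp (norm_nonneg _) f.1.aestronglyMeasurable
    (weakLpENorm_eq_ofReal_norm f).le hB hB'

/-- The class in `WeakLp p μ` of a function with finite weak norm. -/
noncomputable def mk [SigmaFinite μ] (f : Ω → ℝ) (hf : AEStronglyMeasurable f μ)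
    (h : weakLpENorm p μ f < ∞) : WeakLp p μ :=
  ⟨AEEqFun.mk f hf, inferInstance, by rwa [weakLpENorm_congr (AEEqFun.coeFn_mk f hf)]⟩

theorem coeFn_mk [SigmaFinite μ] (f : Ω → ℝ) (hf : AEStronglyMeasurable f μ)
    (h : weakLpENorm p μ f < ∞) : (mk f hf h).1 =ᵐ[μ] f :=
  AEEqFun.coeFn_mk f hf

theorem coeFn_add (f g : WeakLp p μ) : (f + g).1 =ᵐ[μ] f.1 + g.1 :=
  AEEqFun.coeFn_add f.1 g.1

theorem coeFn_sub (f g : WeakLp p μ) : (f - g).1 =ᵐ[μ] f.1 - g.1 :=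
  AEEqFun.coeFn_sub f.1 g.1

theorem coeFn_smul (c : ℝ) (f : WeakLp p μ) : (c • f).1 =ᵐ[μ] c • f.1 :=
  AEEqFun.coeFn_smul c f.1

theorem ext_ae {f g : WeakLp p μ} (h : f.1 =ᵐ[μ] g.1) : f = g :=
  Subtype.ext (AEEqFun.ext h)

/-- A bounded map into functions that is linear up to null sets defines a continuous linear map
into `WeakLp p μ`. -/
theorem exists_clm [SigmaFinite μ] {E : Type*} [NormedAddCommGroup E] [NormedSpace ℝ E]
    (T : E → Ω → ℝ) (hT : ∀ e, AEStronglyMeasurable (T e) μ)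
    (hadd : ∀ e e', T (e + e') =ᵐ[μ] T e + T e') (hsmul : ∀ (c : ℝ) e, T (c • e) =ᵐ[μ] c • T e)
    {K : ℝ} (hK : 0 ≤ K)
    -- The bound is asked for every positive C ≥ ‖e‖ because the excess estimates need C > 0, which
    -- ‖e‖ itself may fail.
    (hbound : ∀ e, ∀ C : ℝ, 0 < C → ‖e‖ ≤ C → weakLpENorm p μ (T e) ≤ ENNReal.ofReal (K * C)) :
    ∃ A : E →L[ℝ] WeakLp p μ, (∀ e, (A e).1 =ᵐ[μ] T e) ∧ ∀ e, ‖A e‖ ≤ K * ‖e‖ := by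
  have hfin : ∀ e, weakLpENorm p μ (T e) < ∞ := fun e =>
    (hbound e (‖e‖ + 1) (by positivity) (by linarith)).trans_lt ENNReal.ofReal_lt_top
  have hb : ∀ e, ‖mk (T e) (hT e) (hfin e)‖ ≤ K * ‖e‖ := by
    intro e
    refine le_of_forall_pos_le_add fun ε hε => ?_
    have h1 : ‖mk (T e) (hT e) (hfin e)‖ ≤ K * (‖e‖ + ε / (K + 1)) := by
      refine norm_le_of_weakLpENorm_le (by positivity) ?_
      rw [weakLpENorm_congr (coeFn_mk _ _ _)]
      exact hbound e _ (by positivity) (by linarith [div_pos hε (by linarith : 0 < K + 1)])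
    have h2 : K * (ε / (K + 1)) ≤ ε := by
      rw [← mul_div_assoc, div_le_iff₀ (by linarith)]
      nlinarith
    linarith
  let A₀ : E →ₗ[ℝ] WeakLp p μ :=
    { toFun := fun e => mk (T e) (hT e) (hfin e)
      map_add' := fun e e' => ext_ae <| by
        filter_upwards [coeFn_mk (p := p) (T (e + e')) (hT _) (hfin _),
          coeFn_mk (p := p) (T e) (hT _) (hfin _), coeFn_mk (p := p) (T e') (hT _) (hfin _),
          coeFn_add (mk (p := p) (T e) (hT e) (hfin e)) (mk (p := p) (T e') (hT e') (hfin e')),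
          hadd e e'] with x h1 h2 h3 h4 h5
        rw [h1, h4, h5, Pi.add_apply, Pi.add_apply, h2, h3]
      map_smul' := fun c e => ext_ae <| by
        filter_upwards [coeFn_mk (p := p) (T (c • e)) (hT _) (hfin _),
          coeFn_mk (p := p) (T e) (hT _) (hfin _),
          coeFn_smul c (mk (p := p) (T e) (hT e) (hfin e)), hsmul c e] with x h1 h2 h4 h5
        rw [h1, RingHom.id_apply, h4, h5, Pi.smul_apply, Pi.smul_apply, h2] }
  exact ⟨A₀.mkContinuous K hb, fun e => coeFn_mk _ (hT e) (hfin e), hb⟩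

theorem lintegral_excess_le (hp : 1 < p) [SigmaFinite μ] (f : WeakLp p μ) {C t : ℝ}
    (hC : 0 < C) (ht : 0 < t) (hfC : ‖f‖ ≤ C) :
    ∫⁻ x, ENNReal.ofReal (|f.1 x| - t) ∂μ ≤ ENNReal.ofReal (C ^ p * t ^ (1 - p)) :=
  _root_.lintegral_excess_le hp f.1.measurable hC ht
    ((weakLpENorm_eq_ofReal_norm f).le.trans (ENNReal.ofReal_le_ofReal hfC))

end WeakLp

/-! ### Complemented subspaces and Pełczyński's decomposition. -/

open scoped BoundedContinuousFunction

/-- `X` is isomorphic to a complemented subspace of `Z`. -/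
def IsComplementedIn (X Z : Type*) [NormedAddCommGroup X] [NormedSpace ℝ X]
    [NormedAddCommGroup Z] [NormedSpace ℝ Z] : Prop :=
  ∃ (A : X →L[ℝ] Z) (B : Z →L[ℝ] X), ∀ x, B (A x) = x

section Decomposition

variable {X Y Z W : Type*} [NormedAddCommGroup X] [NormedSpace ℝ X]
  [NormedAddCommGroup Y] [NormedSpace ℝ Y] [NormedAddCommGroup Z] [NormedSpace ℝ Z]
  [NormedAddCommGroup W] [NormedSpace ℝ W]

theorem IsComplementedIn.trans (h : IsComplementedIn X Y) (h' : IsComplementedIn Y Z) :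
    IsComplementedIn X Z := by
  obtain ⟨A, B, hAB⟩ := h
  obtain ⟨A', B', hAB'⟩ := h'
  exact ⟨A'.comp A, B.comp B', fun x => by simp [hAB, hAB']⟩

theorem IsComplementedIn.refl : IsComplementedIn X X :=
  ⟨.id ℝ X, .id ℝ X, fun _ => rfl⟩

/-- A uniformly bounded sequence of continuous linear maps, bundled. -/
theorem exists_clm_boundedSeq (B : ℕ → X →L[ℝ] Y) (C : ℝ) (hB : ∀ m x, ‖B m x‖ ≤ C * ‖x‖) :
    ∃ T : X →L[ℝ] (ℕ →ᵇ Y), ∀ x m, T x m = B m x := by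
  have hC : ∀ x : X, 0 ≤ C * ‖x‖ := fun x => (norm_nonneg _).trans (hB 0 x)
  let T₀ : X →ₗ[ℝ] (ℕ →ᵇ Y) :=
    { toFun := fun x => BoundedContinuousFunction.ofNormedAddCommGroupDiscrete
        (fun m => B m x) (C * ‖x‖) (fun m => hB m x)
      map_add' := fun x y => by ext m; simp
      map_smul' := fun c x => by ext m; simp }
  refine ⟨T₀.mkContinuous C fun x => ?_, fun x m => rfl⟩
  exact (BoundedContinuousFunction.norm_le (hC x)).2 fun m => hB m x

/-- Evaluation at `m`, on bounded sequences. -/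
noncomputable def evalBoundedSeq (Y : Type*) [NormedAddCommGroup Y] [NormedSpace ℝ Y] (m : ℕ) :
    (ℕ →ᵇ Y) →L[ℝ] Y :=
  LinearMap.mkContinuous
    { toFun := fun z => z m
      map_add' := fun _ _ => rfl
      map_smul' := fun _ _ => rfl } 1
    (fun z => by simpa using z.norm_coe_le_norm m)

@[simp] theorem evalBoundedSeq_apply (m : ℕ) (z : ℕ →ᵇ Y) : evalBoundedSeq Y m z = z m := rfl

theorem isComplementedIn_boundedSeq : IsComplementedIn X (ℕ →ᵇ X) := by
  obtain ⟨T, hT⟩ := exists_clm_boundedSeq (fun _ => .id ℝ X) 1 (fun _ x => by simp)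
  exact ⟨T, evalBoundedSeq X 0, fun x => by simp [hT]⟩

theorem nonempty_boundedSeq_congr (e : X ≃L[ℝ] Y) : Nonempty ((ℕ →ᵇ X) ≃L[ℝ] (ℕ →ᵇ Y)) := by
  obtain ⟨T, hT⟩ := exists_clm_boundedSeq
    (fun m => (e : X →L[ℝ] Y).comp (evalBoundedSeq X m)) ‖(e : X →L[ℝ] Y)‖ fun m x =>
      ((e : X →L[ℝ] Y).le_opNorm _).trans
        (mul_le_mul_of_nonneg_left (x.norm_coe_le_norm m) (norm_nonneg _))
  obtain ⟨S, hS⟩ := exists_clm_boundedSeq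
    (fun m => (e.symm : Y →L[ℝ] X).comp (evalBoundedSeq Y m)) ‖(e.symm : Y →L[ℝ] X)‖ fun m x =>
      ((e.symm : Y →L[ℝ] X).le_opNorm _).trans
        (mul_le_mul_of_nonneg_left (x.norm_coe_le_norm m) (norm_nonneg _))
  refine ⟨ContinuousLinearEquiv.equivOfInverse T S (fun x => ?_) (fun x => ?_)⟩
  · ext m; simp [hT, hS]
  · ext m; simp [hT, hS]

/-- Reindexing along the pairing bijection between ℕ × ℕ and ℕ. -/
theorem nonempty_boundedSeq_boundedSeq (X : Type*) [NormedAddCommGroup X] [NormedSpace ℝ X] :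
    Nonempty ((ℕ →ᵇ (ℕ →ᵇ X)) ≃L[ℝ] (ℕ →ᵇ X)) := by
  obtain ⟨T, hT⟩ := exists_clm_boundedSeq
    (fun k => (evalBoundedSeq X k.unpair.2).comp (evalBoundedSeq (ℕ →ᵇ X) k.unpair.1)) 1
    fun k z => by
      rw [one_mul]
      exact ((z k.unpair.1).norm_coe_le_norm _).trans (z.norm_coe_le_norm _)
  choose R hR using fun n : ℕ => exists_clm_boundedSeq
    (fun m => evalBoundedSeq X (Nat.pair n m)) 1 (fun m z => by
      rw [one_mul]; exact z.norm_coe_le_norm _)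
  obtain ⟨S, hS⟩ := exists_clm_boundedSeq R 1 (fun n z => by
    rw [one_mul]
    refine (BoundedContinuousFunction.norm_le (norm_nonneg _)).2 fun m => ?_
    rw [hR]
    exact z.norm_coe_le_norm _)
  refine ⟨ContinuousLinearEquiv.equivOfInverse T S (fun x => ?_) (fun x => ?_)⟩
  · ext n m; simp [hT, hS, hR]
  · ext m; simp [hT, hS, hR]

/-- Shifting the first coordinate. -/
theorem nonempty_prod_boundedSeq_prod (X Y : Type*) [NormedAddCommGroup X] [NormedSpace ℝ X]
    [NormedAddCommGroup Y] [NormedSpace ℝ Y] :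
    Nonempty ((X × (ℕ →ᵇ (X × Y))) ≃L[ℝ] (ℕ →ᵇ (X × Y))) := by
  obtain ⟨T, hT⟩ := exists_clm_boundedSeq (X := X × (ℕ →ᵇ (X × Y)))
    (fun n => Nat.casesOn n
      ((ContinuousLinearMap.fst ℝ X _).prod ((ContinuousLinearMap.snd ℝ X Y).comp
        ((evalBoundedSeq (X × Y) 0).comp (ContinuousLinearMap.snd ℝ X _))))
      (fun k => ((ContinuousLinearMap.fst ℝ X Y).comp
        ((evalBoundedSeq (X × Y) k).comp (ContinuousLinearMap.snd ℝ X _))).prod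
        ((ContinuousLinearMap.snd ℝ X Y).comp
        ((evalBoundedSeq (X × Y) (k + 1)).comp (ContinuousLinearMap.snd ℝ X _))))) 1 (by
    rintro (_ | k) ⟨x, z⟩
    · rw [one_mul]
      exact max_le (le_max_left _ _)
        (((le_max_right _ _).trans (z.norm_coe_le_norm 0)).trans (le_max_right _ _))
    · rw [one_mul]
      exact max_le (((le_max_left _ _).trans (z.norm_coe_le_norm k)).trans (le_max_right _ _))
        (((le_max_right _ _).trans (z.norm_coe_le_norm (k + 1))).trans (le_max_right _ _)))
  obtain ⟨S, hS⟩ := exists_clm_boundedSeq (X := ℕ →ᵇ (X × Y))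
    (fun n => ((ContinuousLinearMap.fst ℝ X Y).comp (evalBoundedSeq (X × Y) (n + 1))).prod
      ((ContinuousLinearMap.snd ℝ X Y).comp (evalBoundedSeq (X × Y) n))) 1 (by
    intro n z
    rw [one_mul]
    exact max_le ((le_max_left _ _).trans (z.norm_coe_le_norm (n + 1)))
        ((le_max_right _ _).trans (z.norm_coe_le_norm n)))
  refine ⟨ContinuousLinearEquiv.equivOfInverse T
    (((ContinuousLinearMap.fst ℝ X Y).comp (evalBoundedSeq (X × Y) 0)).prod S) ?_ ?_⟩
  · rintro ⟨x, z⟩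
    refine Prod.ext ?_ ?_
    · simp [hT]
    · ext n
      · simp [hT, hS]
      · cases n <;> simp [hT, hS]
  · intro z
    ext n
    · cases n <;> simp [hT, hS]
    · cases n <;> simp [hT, hS]

/-- Z splits as X × ker B, so Z ≅ ℓ^∞(Z) ≅ ℓ^∞(X × ker B), and the last space absorbs one more copy
of X by a shift. -/
theorem nonempty_prod_equiv (h : IsComplementedIn X Z) (hZ : Nonempty ((ℕ →ᵇ Z) ≃L[ℝ] Z)) :
    Nonempty ((X × Z) ≃L[ℝ] Z) := by
  obtain ⟨A, B, hAB⟩ := h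
  obtain ⟨z⟩ := hZ
  obtain ⟨b⟩ := nonempty_boundedSeq_congr (ContinuousLinearEquiv.equivOfRightInverse B A hAB)
  obtain ⟨s⟩ := nonempty_prod_boundedSeq_prod X B.ker
  exact ⟨((((ContinuousLinearEquiv.refl ℝ X).prodCongr (z.symm.trans b)).trans s).trans
    b.symm).trans z⟩

/-- Pełczyński's decomposition method. -/
theorem nonempty_equiv_of_isComplementedIn (hZ : Nonempty ((ℕ →ᵇ Z) ≃L[ℝ] Z))
    (h : IsComplementedIn X Z) (h' : IsComplementedIn Z X) : Nonempty (X ≃L[ℝ] Z) := by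
  obtain ⟨e⟩ := nonempty_prod_equiv h hZ
  obtain ⟨d⟩ := nonempty_prod_equiv (IsComplementedIn.refl (X := Z)) hZ
  obtain ⟨A, B, hAB⟩ := h'
  let w := ContinuousLinearEquiv.equivOfRightInverse B A hAB
  -- With W = ker B: X ≅ Z × W ≅ Z × Z × W ≅ Z × X ≅ X × Z ≅ Z.
  refine ⟨(w.trans ((d.symm.prodCongr (.refl ℝ _)).trans
    (ContinuousLinearEquiv.prodAssoc ℝ Z Z B.ker))).trans
    (((ContinuousLinearEquiv.refl ℝ Z).prodCongr w.symm).trans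
    ((ContinuousLinearEquiv.prodComm ℝ Z X).trans e))⟩

end Decomposition

/-! ### Weak limits along ultrafilters, and completeness. -/

open Filter Topology

section UltrafilterLimit

variable {Ω : Type*} [MeasurableSpace Ω]

/-- Along an ultrafilter, a uniformly absolutely continuous sequence of densities over a finite
measure converges weakly to a density. -/
theorem exists_tendsto_setLIntegral_of_isFiniteMeasure {μ : Measure Ω} [IsFiniteMeasure μ]
    (U : Ultrafilter ℕ) (f : ℕ → Ω → ℝ≥0∞) {C : ℝ≥0∞} (hC : C ≠ ∞) {θ : ℝ} (hθ : 0 < θ)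
    (h : ∀ n B, MeasurableSet B → ∫⁻ x in B, f n x ∂μ ≤ C * μ B ^ θ) :
    ∃ g : Ω → ℝ≥0∞, Measurable g ∧ ∀ B, MeasurableSet B →
      Tendsto (fun n => ∫⁻ x in B, f n x ∂μ) U (𝓝 (∫⁻ x in B, g x ∂μ)) := by
  -- The limit exists for every set since [0, ∞] is compact. It is finitely additive; the bound C
  -- μ(B)^θ, which passes to the limit, makes it small on sets of small measure, hence countably
  -- additive and absolutely continuous.
  set m : Set Ω → ℝ≥0∞ := fun B => (U.map fun n => ∫⁻ x in B, f n x ∂μ).lim with hm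
  have hlim : ∀ B, Tendsto (fun n => ∫⁻ x in B, f n x ∂μ) U (𝓝 (m B)) := fun B =>
    (U.map fun n => ∫⁻ x in B, f n x ∂μ).le_nhds_lim
  have hle : ∀ B, MeasurableSet B → m B ≤ C * μ B ^ θ := fun B hB =>
    le_of_tendsto' (hlim B) fun n => h n B hB
  have hadd : ∀ A B, MeasurableSet B → Disjoint A B → m (A ∪ B) = m A + m B := by
    intro A B hB hAB
    refine tendsto_nhds_unique (hlim (A ∪ B)) ?_
    refine ((hlim A).add (hlim B)).congr fun n => ?_
    rw [lintegral_union hB hAB]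
  have hempty : m ∅ = 0 := by
    have := hle ∅ MeasurableSet.empty
    rw [measure_empty, ENNReal.zero_rpow_of_pos hθ, mul_zero] at this
    exact le_antisymm this zero_le
  have hfin : ∀ s : ℕ → Set Ω, (∀ i, MeasurableSet (s i)) → Pairwise (Function.onFun Disjoint s) →
      ∀ N, m (⋃ i < N, s i) = ∑ i ∈ Finset.range N, m (s i) := by
    intro s hs hd N
    induction N with
    | zero => simp [hempty]
    | succ N ih =>
      rw [Finset.sum_range_succ, ← ih, Set.biUnion_lt_succ, hadd _ _ (hs N)]
      rw [Set.disjoint_iUnion₂_left]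
      exact fun i hi => hd hi.ne
  have hsum : ∀ s : ℕ → Set Ω, (∀ i, MeasurableSet (s i)) →
      Pairwise (Function.onFun Disjoint s) → m (⋃ i, s i) = ∑' i, m (s i) := by
    intro s hs hd
    set D : ℕ → Set Ω := fun N => (⋃ i, s i) \ ⋃ i < N, s i with hD
    have hm' : ∀ N, MeasurableSet (⋃ i < N, s i) := fun N =>
      MeasurableSet.biUnion (Set.to_countable _) fun i _ => hs i
    have hDm : ∀ N, MeasurableSet (D N) := fun N => (MeasurableSet.iUnion hs).diff (hm' N)
    have hanti : Antitone D := by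
      intro N M hNM
      refine Set.sdiff_subset_sdiff_right ?_
      exact Set.biUnion_subset_biUnion_left fun i hi => lt_of_lt_of_le hi hNM
    have hinter : ⋂ N, D N = ∅ := by
      ext x
      simp only [hD, Set.mem_iInter, Set.mem_sdiff, Set.mem_iUnion, Set.mem_empty_iff_false,
        iff_false]
      intro hx
      obtain ⟨i, hi⟩ := (hx 0).1
      exact (hx (i + 1)).2 ⟨i, Nat.lt_succ_self i, hi⟩
    have h0 : Tendsto (fun N => m (D N)) atTop (𝓝 0) := by
      have h1 : Tendsto (fun N => μ (D N)) atTop (𝓝 0) := by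
        have := tendsto_measure_iInter_atTop (μ := μ) (s := D)
          (fun N => (hDm N).nullMeasurableSet) hanti ⟨0, measure_ne_top _ _⟩
        rwa [hinter, measure_empty] at this
      have h2 : Tendsto (fun N => C * μ (D N) ^ θ) atTop (𝓝 0) := by
        have := ENNReal.Tendsto.const_mul (h1.ennrpow_const θ) (Or.inr hC)
        rwa [ENNReal.zero_rpow_of_pos hθ, mul_zero] at this
      exact tendsto_of_tendsto_of_tendsto_of_le_of_le tendsto_const_nhds h2 (fun _ => zero_le)
        fun N => hle _ (hDm N)
    have h3 : ∀ N, (∑ i ∈ Finset.range N, m (s i)) + m (D N) = m (⋃ i, s i) := by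
      intro N
      rw [← hfin s hs hd N, ← hadd _ _ (hDm N) Set.disjoint_sdiff_right, hD,
        Set.union_sdiff_cancel (Set.iUnion₂_subset fun i _ => Set.subset_iUnion s i)]
    have h4 := (ENNReal.tendsto_nat_tsum fun i => m (s i)).add h0
    simp only [h3, add_zero] at h4
    exact tendsto_nhds_unique tendsto_const_nhds h4
  let M : Measure Ω := Measure.ofMeasurable (fun s _ => m s) hempty fun s hs hd => hsum s hs hd
  have hM : ∀ s, MeasurableSet s → M s = m s := fun s hs => Measure.ofMeasurable_apply s hs
  have hMfin : IsFiniteMeasure M := ⟨by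
    rw [hM _ MeasurableSet.univ]
    refine (hle _ MeasurableSet.univ).trans_lt ?_
    exact ENNReal.mul_lt_top hC.lt_top
      (ENNReal.rpow_lt_top_of_nonneg hθ.le (measure_ne_top _ _))⟩
  have hac : M ≪ μ := by
    refine Measure.AbsolutelyContinuous.mk fun s hs h0 => ?_
    rw [hM s hs]
    have := hle s hs
    rw [h0, ENNReal.zero_rpow_of_pos hθ, mul_zero] at this
    exact le_antisymm this zero_le
  refine ⟨M.rnDeriv μ, Measure.measurable_rnDeriv _ _, fun B hB => ?_⟩
  rw [← withDensity_apply _ hB, Measure.withDensity_rnDeriv_eq _ _ hac, hM B hB]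
  exact hlim B

theorem exists_tendsto_setLIntegral {μ : Measure Ω} [SigmaFinite μ]
    (U : Ultrafilter ℕ) (f : ℕ → Ω → ℝ≥0∞) {C : ℝ≥0∞} (hC : C ≠ ∞) {θ : ℝ} (hθ : 0 < θ)
    (h : ∀ n B, MeasurableSet B → μ B < ∞ → ∫⁻ x in B, f n x ∂μ ≤ C * μ B ^ θ) :
    ∃ g : Ω → ℝ≥0∞, Measurable g ∧ ∀ B, MeasurableSet B → μ B < ∞ →
      Tendsto (fun n => ∫⁻ x in B, f n x ∂μ) U (𝓝 (∫⁻ x in B, g x ∂μ)) := by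
  have key : ∀ S, MeasurableSet S → μ S < ∞ → ∃ g : Ω → ℝ≥0∞, Measurable g ∧
      ∀ B, MeasurableSet B →
        Tendsto (fun n => ∫⁻ x in B ∩ S, f n x ∂μ) U (𝓝 (∫⁻ x in B ∩ S, g x ∂μ)) := by
    intro S hS hSf
    have : IsFiniteMeasure (μ.restrict S) := ⟨by simpa using hSf⟩
    obtain ⟨g, hg, hg'⟩ := exists_tendsto_setLIntegral_of_isFiniteMeasure (μ := μ.restrict S) U f
      hC hθ (fun n B hB => by
        rw [Measure.restrict_restrict hB, Measure.restrict_apply hB]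
        exact h n _ (hB.inter hS) ((measure_mono Set.inter_subset_right).trans_lt hSf))
    refine ⟨g, hg, fun B hB => ?_⟩
    have := hg' B hB
    rwa [Measure.restrict_restrict hB] at this
  set S : ℕ → Set Ω := disjointed (spanningSets μ) with hSdef
  have hS : ∀ k, MeasurableSet (S k) :=
    MeasurableSet.disjointed (measurableSet_spanningSets μ)
  have hSf : ∀ k, μ (S k) < ∞ := fun k =>
    (measure_mono (disjointed_subset _ k)).trans_lt (measure_spanningSets_lt_top μ k)
  have hSU : ⋃ k, S k = Set.univ := by rw [hSdef, iUnion_disjointed, iUnion_spanningSets]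
  have hSd : Pairwise (Function.onFun Disjoint S) := disjoint_disjointed _
  choose g hg hg' using fun k => key (S k) (hS k) (hSf k)
  refine ⟨fun x => ∑' k, (S k).indicator (g k) x,
    Measurable.tsum fun k => (hg k).indicator (hS k), fun B hB hBf => ?_⟩
  -- B may meet infinitely many pieces, and the limit need not commute with the sum over them. A
  -- density φ obtained on B itself avoids this: it has the same integrals as the glued one over
  -- each piece of B.
  obtain ⟨φ, -, hφ⟩ := key B hB hBf
  have hsplit : ∀ u : Ω → ℝ≥0∞, ∫⁻ x in B, u x ∂μ = ∑' k, ∫⁻ x in S k ∩ B, u x ∂μ := by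
    intro u
    have hU : B = ⋃ k, S k ∩ B := by rw [← Set.iUnion_inter, hSU, Set.univ_inter]
    conv_lhs => rw [hU]
    exact lintegral_iUnion (fun k => (hS k).inter hB)
      (fun i j hij => (hSd hij).mono Set.inter_subset_left Set.inter_subset_left) _
  have h1 := hφ B hB
  rw [Set.inter_self] at h1
  convert h1 using 2
  rw [hsplit, hsplit φ]
  refine tsum_congr fun k => ?_
  have h2 : ∫⁻ x in S k ∩ B, ∑' k, (S k).indicator (g k) x ∂μ = ∫⁻ x in S k ∩ B, g k x ∂μ := by
    refine setLIntegral_congr_fun ((hS k).inter hB) fun x hx => ?_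
    change ∑' j, (S j).indicator (g j) x = g k x
    rw [tsum_eq_single k, Set.indicator_of_mem hx.1]
    intro j hj
    exact Set.indicator_of_notMem (fun hxj => Set.disjoint_left.1 (hSd hj) hxj hx.1) _
  rw [h2]
  refine tendsto_nhds_unique ?_ (hφ (S k) (hS k))
  rw [Set.inter_comm (S k)]
  exact hg' k B hB

theorem exists_tendsto_setIntegral {p : ℝ} (hp : 1 < p) {μ : Measure Ω} [SigmaFinite μ]
    (U : Ultrafilter ℕ) (f : ℕ → Ω → ℝ) (hf : ∀ n, Measurable (f n)) {C : ℝ}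
    (hfC : ∀ n, weakLpENorm p μ (f n) ≤ ENNReal.ofReal C) :
    ∃ g : Ω → ℝ, Measurable g ∧ ∀ B, MeasurableSet B → μ B < ∞ → IntegrableOn g B μ ∧
      Tendsto (fun n => ∫ x in B, f n x ∂μ) U (𝓝 (∫ x in B, g x ∂μ)) := by
  have hθ := one_sub_one_div_pos hp
  have bound : ∀ u : Ω → ℝ, weakLpENorm p μ u ≤ ENNReal.ofReal C → ∀ v : Ω → ℝ≥0∞,
      (∀ x, v x ≤ ‖u x‖ₑ) → ∀ B, MeasurableSet B → μ B < ∞ →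
      ∫⁻ x in B, v x ∂μ ≤ ENNReal.ofReal C * μ B ^ (1 - 1 / p) := by
    intro u hu v hv B hB hBf
    refine (lintegral_mono hv).trans ((setLIntegral_enorm_le_weakLpENorm_mul hp hB hBf).trans ?_)
    gcongr
  have hpos : ∀ n x, ENNReal.ofReal (f n x) ≤ ‖f n x‖ₑ := fun n x => by
    rw [← ofReal_norm]; exact ENNReal.ofReal_le_ofReal (le_abs_self _)
  have hneg : ∀ n x, ENNReal.ofReal (-f n x) ≤ ‖f n x‖ₑ := fun n x => by
    rw [← ofReal_norm]; exact ENNReal.ofReal_le_ofReal (neg_le_abs _)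
  obtain ⟨g, hg, hg'⟩ := exists_tendsto_setLIntegral (μ := μ) U
    (fun n x => ENNReal.ofReal (f n x)) ENNReal.ofReal_ne_top hθ
    (fun n => bound _ (hfC n) _ (hpos n))
  obtain ⟨g', hg1, hg1'⟩ := exists_tendsto_setLIntegral (μ := μ) U
    (fun n x => ENNReal.ofReal (-f n x)) ENNReal.ofReal_ne_top hθ
    (fun n => bound _ (hfC n) _ (hneg n))
  refine ⟨fun x => (g x).toReal - (g' x).toReal, hg.ennreal_toReal.sub hg1.ennreal_toReal,
    fun B hB hBf => ?_⟩
  have hfin : ENNReal.ofReal C * μ B ^ (1 - 1 / p) < ∞ :=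
    ENNReal.mul_lt_top ENNReal.ofReal_lt_top (ENNReal.rpow_lt_top_of_nonneg hθ.le hBf.ne)
  have h1 : ∫⁻ x in B, g x ∂μ < ∞ := (le_of_tendsto' (hg' B hB hBf)
    fun n => bound _ (hfC n) _ (hpos n) B hB hBf).trans_lt hfin
  have h2 : ∫⁻ x in B, g' x ∂μ < ∞ := (le_of_tendsto' (hg1' B hB hBf)
    fun n => bound _ (hfC n) _ (hneg n) B hB hBf).trans_lt hfin
  have i1 : IntegrableOn (fun x => (g x).toReal) B μ :=
    integrable_toReal_of_lintegral_ne_top hg.aemeasurable h1.ne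
  have i2 : IntegrableOn (fun x => (g' x).toReal) B μ :=
    integrable_toReal_of_lintegral_ne_top hg1.aemeasurable h2.ne
  refine ⟨i1.sub i2, ?_⟩
  rw [integral_sub i1 i2, integral_toReal hg.aemeasurable (ae_lt_top hg h1.ne),
    integral_toReal hg1.aemeasurable (ae_lt_top hg1 h2.ne)]
  refine (((ENNReal.tendsto_toReal h1.ne).comp (hg' B hB hBf)).sub
    ((ENNReal.tendsto_toReal h2.ne).comp (hg1' B hB hBf))).congr fun n => ?_
  rw [integral_eq_lintegral_pos_part_sub_lintegral_neg_part]
  · rfl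
  · exact integrableOn_of_weakLpENorm_lt_top hp (hf n).aestronglyMeasurable
      ((hfC n).trans_lt ENNReal.ofReal_lt_top) hB hBf

/-- Lower semicontinuity: ∫_B |g| is the difference of the integrals of g over two fixed sets, where
g ≥ 0 and where g < 0, so weak convergence suffices. -/
theorem weakLpENorm_le_of_tendsto_setIntegral {p : ℝ} (hp : 1 < p) {μ : Measure Ω}
    {F : Filter ℕ} [F.NeBot] {f : ℕ → Ω → ℝ} (hf : ∀ n, AEStronglyMeasurable (f n) μ)
    {C : ℝ} (hC : 0 ≤ C) (hfC : ∀ᶠ n in F, weakLpENorm p μ (f n) ≤ ENNReal.ofReal C)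
    {g : Ω → ℝ} (hg : Measurable g) (hgi : ∀ B, MeasurableSet B → μ B < ∞ → IntegrableOn g B μ)
    (hlim : ∀ B, MeasurableSet B → μ B < ∞ →
      Tendsto (fun n => ∫ x in B, f n x ∂μ) F (𝓝 (∫ x in B, g x ∂μ))) :
    weakLpENorm p μ g ≤ ENNReal.ofReal C := by
  refine weakLpENorm_le_of_forall hp fun B hB _ hBf => ?_
  set P : Set Ω := {x | 0 ≤ g x}
  have hP : MeasurableSet P := measurableSet_le measurable_const hg
  have hf1 : μ (B ∩ P) < ∞ := (measure_mono Set.inter_subset_left).trans_lt hBf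
  have hf2 : μ (B \ P) < ∞ := (measure_mono Set.sdiff_subset).trans_lt hBf
  have hm1 := hB.inter hP
  have hm2 := hB.diff hP
  have e1 : ∫ x in B, |g x| ∂μ = ∫ x in B ∩ P, g x ∂μ - ∫ x in B \ P, g x ∂μ := by
    rw [← integral_inter_add_sdiff hP (hgi B hB hBf).abs, sub_eq_add_neg, ← integral_neg]
    congr 1
    · exact setIntegral_congr_fun hm1 fun x hx => abs_of_nonneg hx.2
    · exact setIntegral_congr_fun hm2 fun x hx => abs_of_neg (not_le.1 hx.2)
  have e2 : ∫ x in B, |g x| ∂μ ≤ C * μ.real B ^ (1 - 1 / p) := by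
    rw [e1]
    refine le_of_tendsto ((hlim _ hm1 hf1).sub (hlim _ hm2 hf2)) ?_
    filter_upwards [hfC] with n hn
    have hi := integrableOn_of_weakLpENorm_lt_top hp (hf n) (hn.trans_lt ENNReal.ofReal_lt_top)
      hB hBf
    refine le_trans ?_ (setIntegral_abs_le_of_weakLpENorm_le hp hC (hf n) hn hB hBf)
    rw [← integral_inter_add_sdiff hP hi.abs]
    have a1 := abs_integral_le_integral_abs (f := f n) (μ := μ.restrict (B ∩ P))
    have a2 := abs_integral_le_integral_abs (f := f n) (μ := μ.restrict (B \ P))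
    linarith [le_abs_self (∫ x in B ∩ P, f n x ∂μ), neg_abs_le (∫ x in B \ P, f n x ∂μ)]
  have e3 := ofReal_integral_norm_eq_lintegral_enorm (hgi B hB hBf)
  rw [← e3]
  refine (ENNReal.ofReal_le_ofReal e2).trans ?_
  rw [ENNReal.ofReal_mul hC, ← ENNReal.ofReal_rpow_of_nonneg measureReal_nonneg
      (one_sub_one_div_pos hp).le, ofReal_measureReal hBf.ne]

end UltrafilterLimit

namespace WeakLp

variable {Ω : Type*} [MeasurableSpace Ω] {p : ℝ} {μ : Measure Ω}

/-- The weak limit of a bounded sequence along an ultrafilter. -/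
theorem exists_ultrafilterLimit [SigmaFinite μ] (hp : 1 < p) (U : Ultrafilter ℕ) :
    ∃ T : (ℕ →ᵇ WeakLp p μ) →L[ℝ] WeakLp p μ, (∀ z, ‖T z‖ ≤ ‖z‖) ∧
      ∀ z B, MeasurableSet B → μ B < ∞ →
        Tendsto (fun n => ∫ x in B, (z n).1 x ∂μ) U (𝓝 (∫ x in B, (T z).1 x ∂μ)) := by
  have hz : ∀ (z : ℕ →ᵇ WeakLp p μ) (C : ℝ), ‖z‖ ≤ C → ∀ n,
      weakLpENorm p μ (z n).1 ≤ ENNReal.ofReal C := fun z C hC n => by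
    rw [weakLpENorm_eq_ofReal_norm]
    exact ENNReal.ofReal_le_ofReal ((z.norm_coe_le_norm n).trans hC)
  choose T hTm hT using fun z : ℕ →ᵇ WeakLp p μ => exists_tendsto_setIntegral hp U
    (fun n => (z n).1) (fun n => (z n).1.measurable) (hz z _ le_rfl)
  obtain ⟨A, hA, hA'⟩ := exists_clm (p := p) (μ := μ) T (fun z => (hTm z).aestronglyMeasurable)
    (fun z w => by
      refine ae_eq_of_forall_setIntegral_eq_of_sigmaFinite
        (fun B hB hBf => (hT _ B hB hBf).1)
        (fun B hB hBf => (hT z B hB hBf).1.add (hT w B hB hBf).1) fun B hB hBf => ?_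
      refine tendsto_nhds_unique (hT (z + w) B hB hBf).2 ?_
      simp only [Pi.add_apply]
      rw [integral_add (hT z B hB hBf).1 (hT w B hB hBf).1]
      refine ((hT z B hB hBf).2.add (hT w B hB hBf).2).congr fun n => ?_
      rw [← integral_add (integrableOn hp _ hB hBf) (integrableOn hp _ hB hBf)]
      refine integral_congr_ae (ae_restrict_of_ae ?_)
      exact (coeFn_add (z n) (w n)).symm)
    (fun c z => by
      refine ae_eq_of_forall_setIntegral_eq_of_sigmaFinite
        (fun B hB hBf => (hT _ B hB hBf).1)
        (fun B hB hBf => (hT z B hB hBf).1.smul c) fun B hB hBf => ?_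
      refine tendsto_nhds_unique (hT (c • z) B hB hBf).2 ?_
      simp only [Pi.smul_apply]
      rw [integral_smul]
      refine ((hT z B hB hBf).2.const_smul c).congr fun n => ?_
      rw [← integral_smul]
      refine integral_congr_ae (ae_restrict_of_ae ?_)
      exact (coeFn_smul c (z n)).symm)
    zero_le_one
    (fun z C hC0 hC => by
      rw [one_mul]
      exact weakLpENorm_le_of_tendsto_setIntegral (F := U) hp
        (fun n => (z n).1.aestronglyMeasurable) hC0.le (Eventually.of_forall (hz z C hC)) (hTm z)
        (fun B hB hBf => (hT z B hB hBf).1) (fun B hB hBf => (hT z B hB hBf).2))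
  refine ⟨A, fun z => by simpa using hA' z, fun z B hB hBf => ?_⟩
  rw [integral_congr_ae (ae_restrict_of_ae (hA z))]
  exact (hT z B hB hBf).2

/-- A Cauchy sequence is bounded and so has a weak ultrafilter limit; semicontinuity applied to u_m
- u_n, with m fixed, turns it into a norm limit. -/
theorem completeSpace [SigmaFinite μ] (hp : 1 < p) : CompleteSpace (WeakLp p μ) := by
  refine Metric.complete_of_cauchySeq_tendsto fun u hu => ?_
  obtain ⟨R, -, hR⟩ := cauchySeq_bdd hu
  have hR' : ∀ n, ‖u n‖ ≤ R + ‖u 0‖ := fun n => by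
    have h1 := hR n 0
    rw [dist_eq_norm] at h1
    have h2 := norm_sub_norm_le (u n) (u 0)
    linarith
  set z := BoundedContinuousFunction.ofNormedAddCommGroupDiscrete u _ hR' with hz
  obtain ⟨T, -, hT⟩ := exists_ultrafilterLimit (p := p) (μ := μ) hp (hyperfilter ℕ)
  refine ⟨T z, Metric.tendsto_atTop.2 fun ε hε => ?_⟩
  obtain ⟨N, hN⟩ := Metric.cauchySeq_iff.1 hu (ε / 2) (by positivity)
  refine ⟨N, fun m hm => ?_⟩
  rw [dist_eq_norm]
  refine lt_of_le_of_lt ?_ (half_lt_self hε)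
  refine norm_le_of_weakLpENorm_le (by positivity) ?_
  refine weakLpENorm_le_of_tendsto_setIntegral (F := hyperfilter ℕ) hp
    (f := fun n => (u m - u n).1) (fun n => (u m - u n).1.aestronglyMeasurable) (by positivity)
    ?_ (u m - T z).1.measurable (fun B hB hBf => integrableOn hp _ hB hBf) fun B hB hBf => ?_
  · have : ∀ᶠ n in atTop, weakLpENorm p μ (u m - u n).1 ≤ ENNReal.ofReal (ε / 2) := by
      filter_upwards [eventually_ge_atTop N] with n hn
      rw [weakLpENorm_eq_ofReal_norm, ← dist_eq_norm]
      exact ENNReal.ofReal_le_ofReal (hN m hm n hn).le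
    exact this.filter_mono Nat.hyperfilter_le_atTop
  · have e : ∀ v : WeakLp p μ, ∫ x in B, (u m - v).1 x ∂μ
        = ∫ x in B, (u m).1 x ∂μ - ∫ x in B, v.1 x ∂μ := fun v => by
      rw [← integral_sub (integrableOn hp _ hB hBf) (integrableOn hp _ hB hBf)]
      exact integral_congr_ae (ae_restrict_of_ae (coeFn_sub _ _))
    simp only [e]
    exact (hT z B hB hBf).const_sub _

end WeakLp

/-! ### Averages over the fibres of a labelling map. -/

section FiberAverage

variable {Ω κ : Type*} [MeasurableSpace Ω] {μ : Measure Ω} {π : Ω → κ}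

/-- The averages of `f` over the fibres of `π` lying over `J`, extended by zero. -/
noncomputable def fiberAverage (μ : Measure Ω) (π : Ω → κ) (J : Set κ) (f : Ω → ℝ) : κ → ℝ :=
  J.indicator fun k => ⨍ x in π ⁻¹' {k}, f x ∂μ

theorem fiberAverage_of_mem {J : Set κ} {f : Ω → ℝ} {k : κ} (hk : k ∈ J) :
    fiberAverage μ π J f k = ⨍ x in π ⁻¹' {k}, f x ∂μ :=
  Set.indicator_of_mem hk _

theorem fiberAverage_of_notMem {J : Set κ} {f : Ω → ℝ} {k : κ} (hk : k ∉ J) :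
    fiberAverage μ π J f k = 0 :=
  Set.indicator_of_notMem hk _

theorem fiberAverage_congr {J : Set κ} {f g : Ω → ℝ} (h : f =ᵐ[μ] g) :
    fiberAverage μ π J f = fiberAverage μ π J g := by
  unfold fiberAverage
  congr 1
  ext k
  rw [setAverage_eq, setAverage_eq, integral_congr_ae (ae_restrict_of_ae h)]

theorem fiberAverage_add {J : Set κ} {f g : Ω → ℝ}
    (hf : ∀ k ∈ J, IntegrableOn f (π ⁻¹' {k}) μ) (hg : ∀ k ∈ J, IntegrableOn g (π ⁻¹' {k}) μ) :
    fiberAverage μ π J (f + g) = fiberAverage μ π J f + fiberAverage μ π J g := by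
  ext k
  by_cases hk : k ∈ J
  · simp only [Pi.add_apply, fiberAverage_of_mem hk, setAverage_eq]
    rw [integral_add (hf k hk) (hg k hk), smul_add]
  · simp [fiberAverage_of_notMem hk]

theorem fiberAverage_smul {J : Set κ} (c : ℝ) (f : Ω → ℝ) :
    fiberAverage μ π J (c • f) = c • fiberAverage μ π J f := by
  ext k
  by_cases hk : k ∈ J
  · simp only [Pi.smul_apply, fiberAverage_of_mem hk, setAverage_eq]
    rw [integral_smul, smul_comm]
  · simp [fiberAverage_of_notMem hk]

theorem fiberAverage_comp [MeasurableSpace κ] [MeasurableSingletonClass κ]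
    {J : Set κ} {a : κ → ℝ} (hπ : Measurable π) {k : κ} (hk : k ∈ J)
    (h0 : μ (π ⁻¹' {k}) ≠ 0) (h1 : μ (π ⁻¹' {k}) < ∞) :
    fiberAverage μ π J (fun x => a (π x)) k = a k := by
  rw [fiberAverage_of_mem hk, setAverage_eq,
    setIntegral_congr_fun (g := fun _ => a k) (hπ (measurableSet_singleton k))
      (fun x hx => congrArg a hx), setIntegral_const, smul_smul, smul_eq_mul,
    inv_mul_cancel₀ (measureReal_ne_zero_iff h1.ne |>.2 h0), one_mul]

end FiberAverage

section Fibers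

variable {Ω κ : Type*} [MeasurableSpace Ω] [MeasurableSpace κ] [MeasurableSingletonClass κ]
  [Countable κ] {μ : Measure Ω} {π : Ω → κ} {p : ℝ}

theorem lintegral_comp_eq_tsum (hπ : Measurable π) (φ : κ → ℝ≥0∞) :
    ∫⁻ x, φ (π x) ∂μ = ∑' k, φ k * μ (π ⁻¹' {k}) := by
  rw [← lintegral_map (measurable_of_countable φ) hπ, lintegral_countable']
  exact tsum_congr fun k => by rw [Measure.map_apply hπ (measurableSet_singleton k)]

theorem tsum_setLIntegral_fiber (hπ : Measurable π) (u : Ω → ℝ≥0∞) :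
    ∑' k, ∫⁻ x in π ⁻¹' {k}, u x ∂μ = ∫⁻ x, u x ∂μ := by
  rw [← lintegral_iUnion (fun k => hπ (measurableSet_singleton k))
    (fun i j hij => Set.disjoint_left.2 fun x hx hx' => hij (hx.symm.trans hx')),
    show ⋃ k, π ⁻¹' {k} = Set.univ by ext x; simp, Measure.restrict_univ]

/-- Jensen's inequality for the average of `f` over `S` and the convex function
`x ↦ (c |x| - t)⁺`. -/
theorem ofReal_excess_average_mul_le {f : Ω → ℝ} {S : Set Ω} (hS : μ S < ∞)
    (hf : IntegrableOn f S μ) {c t : ℝ} (hc : 0 ≤ c) :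
    ENNReal.ofReal (c * |⨍ x in S, f x ∂μ| - t) * μ S
      ≤ ∫⁻ x in S, ENNReal.ofReal (c * |f x| - t) ∂μ := by
  rcases eq_or_ne (μ S) 0 with h0 | h0
  · simp [h0]
  have hr : 0 < μ.real S := ENNReal.toReal_pos h0 hS.ne
  have hi : IntegrableOn (fun x => c * |f x| - t) S μ :=
    (hf.abs.const_mul c).sub (integrableOn_const hS.ne)
  -- The estimate is first proved without positive parts; taking them afterwards only enlarges the
  -- right-hand side.
  have h1 : (c * |⨍ x in S, f x ∂μ| - t) * μ.real S ≤ ∫ x in S, (c * |f x| - t) ∂μ := by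
    rw [integral_sub (hf.abs.const_mul c) (integrableOn_const hS.ne), integral_const_mul,
      setIntegral_const, smul_eq_mul, setAverage_eq, smul_eq_mul, abs_mul, abs_inv,
      abs_of_pos hr, sub_mul, mul_comm (μ.real S) t]
    have h2 := mul_le_mul_of_nonneg_left
      (abs_integral_le_integral_abs (f := f) (μ := μ.restrict S)) hc
    have h3 : c * ((μ.real S)⁻¹ * |∫ x in S, f x ∂μ|) * μ.real S = c * |∫ x in S, f x ∂μ| := by
      field_simp
    linarith
  rw [← ofReal_measureReal hS.ne, ← ENNReal.ofReal_mul' hr.le]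
  refine (ENNReal.ofReal_le_ofReal h1).trans ?_
  rw [integral_eq_lintegral_pos_part_sub_lintegral_neg_part hi]
  refine (ENNReal.ofReal_le_ofReal (sub_le_self _ ENNReal.toReal_nonneg)).trans ?_
  exact ENNReal.ofReal_toReal_le

theorem tsum_excess_fiberAverage_le (hπ : Measurable π) {J : Set κ} {f : Ω → ℝ}
    (hJ : ∀ k ∈ J, μ (π ⁻¹' {k}) < ∞) (hf : ∀ k ∈ J, IntegrableOn f (π ⁻¹' {k}) μ) {c t : ℝ}
    (hc : 0 ≤ c) (ht : 0 ≤ t) :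
    ∑' k, ENNReal.ofReal (c * |fiberAverage μ π J f k| - t) * μ (π ⁻¹' {k})
      ≤ ∫⁻ x in π ⁻¹' J, ENNReal.ofReal (c * |f x| - t) ∂μ := by
  rw [← tsum_setLIntegral_fiber hπ]
  refine ENNReal.tsum_le_tsum fun k => ?_
  by_cases hk : k ∈ J
  · rw [fiberAverage_of_mem hk, Measure.restrict_restrict (hπ (measurableSet_singleton k)),
      Set.inter_eq_self_of_subset_left (Set.preimage_mono (Set.singleton_subset_iff.2 hk))]
    exact ofReal_excess_average_mul_le (hJ k hk) (hf k hk) hc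
  · rw [fiberAverage_of_notMem hk, abs_zero, mul_zero, zero_sub,
      ENNReal.ofReal_of_nonpos (by linarith), zero_mul]
    exact zero_le

/-- Averaging over fibres preserves the excess estimates. -/
theorem tsum_excess_fiberAverage_le_of_norm_le (hp : 1 < p) [SigmaFinite μ] (hπ : Measurable π)
    {J : Set κ} (hJ : ∀ k ∈ J, μ (π ⁻¹' {k}) < ∞) (f : WeakLp p μ) {C c t : ℝ} (hC : 0 < C)
    (hfC : ‖f‖ ≤ C) (hc : 0 < c) (ht : 0 < t) :
    ∑' k, ENNReal.ofReal (c * |fiberAverage μ π J f.1 k| - t) * μ (π ⁻¹' {k})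
      ≤ ENNReal.ofReal (c ^ p * C ^ p * t ^ (1 - p)) := by
  refine (tsum_excess_fiberAverage_le hπ hJ
    (fun k hk => WeakLp.integrableOn hp f (hπ (measurableSet_singleton k)) (hJ k hk))
    hc.le ht.le).trans ((setLIntegral_le_lintegral _ _).trans ?_)
  have h1 := WeakLp.lintegral_excess_le hp f hC (div_pos ht hc) hfC
  calc ∫⁻ x, ENNReal.ofReal (c * |f.1 x| - t) ∂μ
      = ENNReal.ofReal c * ∫⁻ x, ENNReal.ofReal (|f.1 x| - t / c) ∂μ := by
        rw [← lintegral_const_mul' _ _ ENNReal.ofReal_ne_top]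
        refine lintegral_congr fun x => ?_
        rw [← ENNReal.ofReal_mul hc.le]
        congr 1; field_simp
    _ ≤ ENNReal.ofReal c * ENNReal.ofReal (C ^ p * (t / c) ^ (1 - p)) := by gcongr
    _ = _ := by
        rw [← ENNReal.ofReal_mul hc.le]
        congr 1
        rw [Real.div_rpow ht.le hc.le, Real.rpow_sub hc, Real.rpow_one]
        have : 0 < c ^ p := by positivity
        field_simp

theorem rpow_two_mul_rpow (hp : 1 < p) {C : ℝ} (hC : 0 < C) :
    2 * (2 * C ^ p) ^ (1 / p) = 2 * 2 ^ (1 / p) * C := by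
  rw [Real.mul_rpow (by norm_num) (by positivity), ← Real.rpow_mul hC.le,
    mul_one_div_cancel (by linarith), Real.rpow_one, mul_assoc]

theorem two_mul_rpow_rpow (hp : 1 < p) {C : ℝ} (hC : 0 < C) :
    2 * (C ^ p) ^ (1 / p) = 2 * C := by
  rw [← Real.rpow_mul hC.le, mul_one_div_cancel (by linarith), Real.rpow_one]

/-- If all the fibres of `π` have positive finite measure, then composition with `π` embeds
`WeakLp p ν`, `ν = μ.map π`, as a complemented subspace of `WeakLp p μ`. -/
theorem isComplementedIn_of_measurePreserving (hp : 1 < p) [SigmaFinite μ] {ν : Measure κ}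
    [SigmaFinite ν] (hπ : MeasurePreserving π μ ν) (h0 : ∀ k, ν {k} ≠ 0) (h1 : ∀ k, ν {k} < ∞) :
    IsComplementedIn (WeakLp p ν) (WeakLp p μ) := by
  have hν : ∀ k, μ (π ⁻¹' {k}) = ν {k} := fun k =>
    hπ.measure_preimage (measurableSet_singleton k).nullMeasurableSet
  have hJ : ∀ k ∈ (Set.univ : Set κ), μ (π ⁻¹' {k}) < ∞ := fun k _ => by rw [hν]; exact h1 k
  -- Every point is an atom of ν, so classes are functions.
  have hae : ∀ {f g : κ → ℝ}, f =ᵐ[ν] g → f = g := fun {f g} h => by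
    ext k
    by_contra hk
    exact h0 k (measure_mono_null (Set.singleton_subset_iff.2 hk) (ae_iff.1 h))
  have hi : ∀ (f : WeakLp p μ), ∀ k ∈ (Set.univ : Set κ), IntegrableOn f.1 (π ⁻¹' {k}) μ :=
    fun f k hk => WeakLp.integrableOn hp f (hπ.measurable (measurableSet_singleton k)) (hJ k hk)
  obtain ⟨A, hA, -⟩ := WeakLp.exists_clm (p := p) (μ := μ) (E := WeakLp p ν) (K := 2)
    (fun f x => f.1 (π x))
    (fun f => (f.1.measurable.comp hπ.measurable).aestronglyMeasurable)
    (fun f g => hπ.quasiMeasurePreserving.ae_eq_comp (WeakLp.coeFn_add f g))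
    (fun c f => hπ.quasiMeasurePreserving.ae_eq_comp (WeakLp.coeFn_smul c f)) zero_le_two
    (fun f C hC hfC => by
      rw [← two_mul_rpow_rpow hp hC]
      refine weakLpENorm_le_of_lintegral_excess_le hp (by positivity) fun t ht => ?_
      rw [hπ.lintegral_comp (f := fun k => ENNReal.ofReal (|f.1 k| - t))
        (measurable_of_countable _)]
      exact WeakLp.lintegral_excess_le hp f hC ht hfC)
  obtain ⟨B, hB, -⟩ := WeakLp.exists_clm (p := p) (μ := ν) (E := WeakLp p μ) (K := 2)
    (fun f => fiberAverage μ π Set.univ f.1)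
    (fun f => (measurable_of_countable _).aestronglyMeasurable)
    (fun f g => by
      rw [fiberAverage_congr (WeakLp.coeFn_add f g), fiberAverage_add (hi f) (hi g)])
    (fun c f => by
      rw [fiberAverage_congr (WeakLp.coeFn_smul c f), fiberAverage_smul]) zero_le_two
    (fun f C hC hfC => by
      rw [← two_mul_rpow_rpow hp hC]
      refine weakLpENorm_le_of_lintegral_excess_le hp (by positivity) fun t ht => ?_
      rw [lintegral_countable']
      have := tsum_excess_fiberAverage_le_of_norm_le hp hπ.measurable hJ f hC hfC one_pos ht
      simpa [hν] using this)
  refine ⟨A, B, fun f => WeakLp.ext_ae ((hB (A f)).trans (Eq.eventuallyEq ?_))⟩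
  rw [fiberAverage_congr (hA f)]
  ext k
  exact fiberAverage_comp hπ.measurable (Set.mem_univ k) (by rw [hν]; exact h0 k)
    (hJ k (Set.mem_univ k))

end Fibers

/-- Extension by zero off s, followed by restriction to s, is the identity; both maps have norm at
most 1. -/
theorem isComplementedIn_restrict {Ω : Type*} [MeasurableSpace Ω] {p : ℝ} (hp : 1 < p)
    {μ ν : Measure Ω} [SigmaFinite μ] [SigmaFinite ν] {s : Set Ω} (hs : MeasurableSet s)
    (hν : ν = μ.restrict s) : IsComplementedIn (WeakLp p ν) (WeakLp p μ) := by
  have hθ := (one_sub_one_div_pos hp).le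
  have hle : ν ≤ μ := hν ▸ Measure.restrict_le_self
  have hind : ∀ {f g : Ω → ℝ}, f =ᵐ[ν] g → s.indicator f =ᵐ[μ] s.indicator g := by
    intro f g h
    rw [hν] at h
    exact (ae_eq_restrict_iff_indicator_ae_eq hs).1 h
  have hlint : ∀ (u : Ω → ℝ≥0∞) (B : Set Ω),
      ∫⁻ x in B, s.indicator u x ∂μ = ∫⁻ x in B, u x ∂ν := by
    intro u B
    rw [lintegral_indicator hs, hν, Measure.restrict_comm hs]
  have hsν : ∀ u : Ω → ℝ, s.indicator u =ᵐ[ν] u := by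
    rw [hν]
    exact fun u => indicator_ae_eq_restrict hs
  obtain ⟨A, hA, -⟩ := WeakLp.exists_clm (p := p) (μ := μ) (E := WeakLp p ν) (K := 1)
    (fun f => s.indicator f.1) (fun f => (f.1.measurable.indicator hs).aestronglyMeasurable)
    (fun f g => (hind (WeakLp.coeFn_add f g)).trans (by rw [Set.indicator_add']))
    (fun c f => (hind (WeakLp.coeFn_smul c f)).trans
      (Eq.eventuallyEq (Set.indicator_const_smul s c f.1)))
    zero_le_one
    (fun f C hC hfC => by
      rw [one_mul]
      refine weakLpENorm_le_of_forall hp fun B hB _ hBf => ?_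
      have h1 := setLIntegral_enorm_le_weakLpENorm_mul (f := f.1) hp hB ((hle B).trans_lt hBf)
      rw [WeakLp.weakLpENorm_eq_ofReal_norm] at h1
      calc ∫⁻ x in B, ‖s.indicator f.1 x‖ₑ ∂μ = ∫⁻ x in B, ‖f.1 x‖ₑ ∂ν := by
            simp_rw [enorm_indicator_eq_indicator_enorm]
            exact hlint _ _
        _ ≤ _ := h1
        _ ≤ _ := by gcongr)
  obtain ⟨B, hB, -⟩ := WeakLp.exists_clm (p := p) (μ := ν) (E := WeakLp p μ) (K := 1)
    (fun f => f.1) (fun f => f.1.measurable.aestronglyMeasurable)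
    (fun f g => hle.absolutelyContinuous.ae_eq (WeakLp.coeFn_add f g))
    (fun c f => hle.absolutelyContinuous.ae_eq (WeakLp.coeFn_smul c f)) zero_le_one
    (fun f C hC hfC => by
      rw [one_mul]
      refine weakLpENorm_le_of_forall hp fun B hB _ hBf => ?_
      rw [hν, Measure.restrict_apply hB] at hBf
      have h1 := setLIntegral_enorm_le_weakLpENorm_mul (f := f.1) hp (hB.inter hs) hBf
      rw [WeakLp.weakLpENorm_eq_ofReal_norm] at h1
      rw [hν, Measure.restrict_restrict hB, Measure.restrict_apply hB]
      refine h1.trans ?_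
      gcongr)
  refine ⟨A, B, fun f => WeakLp.ext_ae ((hB (A f)).trans ?_)⟩
  refine (hle.absolutelyContinuous.ae_eq (hA f)).trans (hsν _)

/-! ### Moving one block from cells of measure s to cells of measure d. -/

section Block

variable {Ω κ : Type*} [MeasurableSpace Ω] {μ : Measure Ω} {π : Ω → κ} {p : ℝ} {J : Finset κ}
  {s d : ℝ}

theorem div_mul_scale_mul_rpow_mass {p s d : ℝ} (hp : 1 < p) (hs : 0 < s) (hd : 0 < d) {N C : ℝ} (hN : 0 ≤ N) :
    d / s * ((s / d) ^ (1 / p) * (C * (N * s) ^ (1 - 1 / p))) = C * (N * d) ^ (1 - 1 / p) := by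
  rw [Real.mul_rpow hN hs.le, Real.mul_rpow hN hd.le, Real.div_rpow hs.le hd.le,
    Real.rpow_sub hs, Real.rpow_sub hd, Real.rpow_one, Real.rpow_one]
  have : 0 < s ^ (1 / p) := by positivity
  have : 0 < d ^ (1 / p) := by positivity
  field_simp

theorem tsum_excess_mul_eq (hs : 0 < s) (hd : 0 < d)
    (hJ : ∀ k ∈ J, μ (π ⁻¹' {k}) = ENNReal.ofReal s) (f : Ω → ℝ) (c : ℝ) {t : ℝ} (ht : 0 ≤ t) :
    ∑' k, ENNReal.ofReal (c * |fiberAverage μ π J f k| - t) * ENNReal.ofReal d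
      = ENNReal.ofReal (d / s) *
        ∑' k, ENNReal.ofReal (c * |fiberAverage μ π J f k| - t) * μ (π ⁻¹' {k}) := by
  rw [← ENNReal.tsum_mul_left]
  refine tsum_congr fun k => ?_
  by_cases hk : k ∈ J
  · rw [hJ k hk, mul_left_comm, ← ENNReal.ofReal_mul (p := d / s) (by positivity),
      div_mul_cancel₀ _ hs.ne']
  · rw [fiberAverage_of_notMem (by simpa using hk), abs_zero, mul_zero, zero_sub,
      ENNReal.ofReal_of_nonpos (by linarith)]
    simp

variable [MeasurableSpace κ] [MeasurableSingletonClass κ]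

/-- The norm bounds a cell average by C s^{-1/p}; the scaling turns this into C d^{-1/p}, which is
at most t. -/
theorem tsum_excess_transplant_eq_zero (hp : 1 < p) (hπ : Measurable π)
    (hs : 0 < s) (hd : 0 < d) (hJ : ∀ k ∈ J, μ (π ⁻¹' {k}) = ENNReal.ofReal s) (f : WeakLp p μ)
    {C t : ℝ} (hC : 0 < C) (hfC : ‖f‖ ≤ C) (ht : 0 < t) (hdt : (C / t) ^ p ≤ d) :
    ∑' k, ENNReal.ofReal ((s / d) ^ (1 / p) * |fiberAverage μ π J f.1 k| - t) * ENNReal.ofReal d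
      = 0 := by
  refine ENNReal.tsum_eq_zero.2 fun k => ?_
  have key : (s / d) ^ (1 / p) * |fiberAverage μ π J f.1 k| ≤ t := by
    by_cases hk : k ∈ J
    · rw [fiberAverage_of_mem (by simpa using hk), setAverage_eq, smul_eq_mul, abs_mul, abs_inv,
        abs_of_nonneg measureReal_nonneg, measureReal_def, hJ k hk, ENNReal.toReal_ofReal hs.le]
      have hfin : μ (π ⁻¹' {k}) < ∞ := by rw [hJ k hk]; exact ENNReal.ofReal_lt_top
      have h1 := WeakLp.setIntegral_abs_le hp f (hπ (measurableSet_singleton k)) hfin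
      rw [measureReal_def, hJ k hk, ENNReal.toReal_ofReal hs.le] at h1
      have h2 : |∫ x in π ⁻¹' {k}, f.1 x ∂μ| ≤ C * s ^ (1 - 1 / p) :=
        (abs_integral_le_integral_abs).trans (h1.trans (by gcongr))
      have h3 : C / t ≤ d ^ (1 / p) := by
        have := Real.rpow_le_rpow (by positivity) hdt (by positivity : 0 ≤ 1 / p)
        rwa [← Real.rpow_mul (by positivity), mul_one_div_cancel (by linarith),
          Real.rpow_one] at this
      calc (s / d) ^ (1 / p) * (s⁻¹ * |∫ x in π ⁻¹' {k}, f.1 x ∂μ|)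
          ≤ (s / d) ^ (1 / p) * (s⁻¹ * (C * s ^ (1 - 1 / p))) := by gcongr
        _ = C / d ^ (1 / p) := by
            rw [Real.div_rpow hs.le hd.le, Real.rpow_sub hs, Real.rpow_one]
            have : 0 < s ^ (1 / p) := by positivity
            field_simp
        _ ≤ t := by
            rw [div_le_iff₀ (by positivity)]
            rw [div_le_iff₀ ht] at h3
            linarith
    · rw [fiberAverage_of_notMem (by simpa using hk), abs_zero, mul_zero]
      exact ht.le
  rw [ENNReal.ofReal_of_nonpos (by linarith), zero_mul]

variable [Countable κ]

/-- Averaging over cells of measure `s` and transplanting to cells of measure `d`, scaled by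
`(s / d) ^ (1 / p)`, preserves the excess estimates. -/
theorem tsum_excess_transplant_le (hp : 1 < p) [SigmaFinite μ] (hπ : Measurable π) (hs : 0 < s)
    (hd : 0 < d) (hJ : ∀ k ∈ J, μ (π ⁻¹' {k}) = ENNReal.ofReal s) (f : WeakLp p μ) {C t : ℝ}
    (hC : 0 < C) (hfC : ‖f‖ ≤ C) (ht : 0 < t) :
    ∑' k, ENNReal.ofReal ((s / d) ^ (1 / p) * |fiberAverage μ π J f.1 k| - t) * ENNReal.ofReal d
      ≤ ENNReal.ofReal (C ^ p * t ^ (1 - p)) := by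
  rw [tsum_excess_mul_eq hs hd hJ _ _ ht.le]
  have h := tsum_excess_fiberAverage_le_of_norm_le hp hπ (J := (J : Set κ))
    (fun k hk => by rw [hJ k (by simpa using hk)]; exact ENNReal.ofReal_lt_top) f hC hfC
    (c := (s / d) ^ (1 / p)) (by positivity) ht
  calc _ ≤ ENNReal.ofReal (d / s) *
        ENNReal.ofReal (((s / d) ^ (1 / p)) ^ p * C ^ p * t ^ (1 - p)) := by gcongr
    _ = _ := by
      rw [← ENNReal.ofReal_mul (by positivity), ← Real.rpow_mul (by positivity),
        one_div_mul_cancel (by linarith), Real.rpow_one]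
      congr 1
      field_simp

/-- A bound uniform in t: drop t and apply the norm to the union of the cells, of measure `J.card *
s`. It controls the blocks whose cells are small. -/
theorem tsum_excess_transplant_le_of_card (hp : 1 < p) (hπ : Measurable π)
    (hs : 0 < s) (hd : 0 < d) (hJ : ∀ k ∈ J, μ (π ⁻¹' {k}) = ENNReal.ofReal s) (f : WeakLp p μ)
    {C t : ℝ} (hC : 0 < C) (hfC : ‖f‖ ≤ C) (ht : 0 < t) :
    ∑' k, ENNReal.ofReal ((s / d) ^ (1 / p) * |fiberAverage μ π J f.1 k| - t) * ENNReal.ofReal d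
      ≤ ENNReal.ofReal (C * (J.card * d) ^ (1 - 1 / p)) := by
  have hθ := (one_sub_one_div_pos hp).le
  have hJ' : ∀ k ∈ (J : Set κ), μ (π ⁻¹' {k}) < ∞ := fun k hk => by
    rw [hJ k (by simpa using hk)]; exact ENNReal.ofReal_lt_top
  have hc : 0 ≤ (s / d) ^ (1 / p) := by positivity
  have hm : μ (π ⁻¹' J) = ENNReal.ofReal (J.card * s) := by
    rw [← sum_measure_preimage_singleton J fun k _ => hπ (measurableSet_singleton k),
      Finset.sum_congr rfl hJ, Finset.sum_const, nsmul_eq_mul,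
      ENNReal.ofReal_mul (by positivity), ENNReal.ofReal_natCast]
  rw [tsum_excess_mul_eq hs hd hJ _ _ ht.le]
  calc _ ≤ ENNReal.ofReal (d / s) * (ENNReal.ofReal ((s / d) ^ (1 / p)) *
        (ENNReal.ofReal C * ENNReal.ofReal (J.card * s) ^ (1 - 1 / p))) := by
        gcongr
        refine (tsum_excess_fiberAverage_le hπ hJ' (fun k hk =>
          WeakLp.integrableOn hp f (hπ (measurableSet_singleton k)) (hJ' k hk)) hc ht.le).trans ?_
        have h1 := setLIntegral_enorm_le_weakLpENorm_mul (f := f.1) (μ := μ) hp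
          (hπ J.measurableSet) (by rw [hm]; exact ENNReal.ofReal_lt_top)
        rw [WeakLp.weakLpENorm_eq_ofReal_norm, hm] at h1
        calc ∫⁻ x in π ⁻¹' J, ENNReal.ofReal ((s / d) ^ (1 / p) * |f.1 x| - t) ∂μ
            ≤ ∫⁻ x in π ⁻¹' J, ENNReal.ofReal ((s / d) ^ (1 / p)) * ‖f.1 x‖ₑ ∂μ := by
              refine lintegral_mono fun x => ?_
              rw [← ofReal_norm, ← ENNReal.ofReal_mul hc, Real.norm_eq_abs]
              exact ENNReal.ofReal_le_ofReal (by linarith)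
          _ = ENNReal.ofReal ((s / d) ^ (1 / p)) * ∫⁻ x in π ⁻¹' J, ‖f.1 x‖ₑ ∂μ :=
              lintegral_const_mul' _ _ ENNReal.ofReal_ne_top
          _ ≤ _ := by
              gcongr
              refine h1.trans ?_
              gcongr
    _ = _ := by
        rw [ENNReal.ofReal_rpow_of_nonneg (by positivity) hθ, ← ENNReal.ofReal_mul hC.le,
          ← ENNReal.ofReal_mul hc, ← ENNReal.ofReal_mul (by positivity),
          div_mul_scale_mul_rpow_mass hp hs hd (by positivity)]

end Block

/-- At each height at most one block is only partly used; the blocks of smaller cells are dominated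
by a sum of their total masses, the blocks of larger cells vanish. -/
theorem tsum_le_of_lacunary {b : ℕ → ℝ≥0∞} {d w : ℕ → ℝ} {X C θ σ : ℝ} (hC : 0 ≤ C)
    (hθ : 0 ≤ θ) (hd0 : ∀ i, 0 < d i) (hd : Function.Injective d) (hw : ∀ i, 0 ≤ w i)
    (hlac : ∀ (i : ℕ) (F : Finset ℕ), (∀ j ∈ F, d j < d i) → ∑ j ∈ F, w j ≤ d i ^ θ)
    (hX : 0 ≤ X) (hbX : ∀ i, b i ≤ ENNReal.ofReal X) (hbw : ∀ i, b i ≤ ENNReal.ofReal (C * w i))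
    (hb0 : ∀ i, σ ≤ d i → b i = 0) (hσ : C * σ ^ θ ≤ X) :
    ∑' i, b i ≤ ENNReal.ofReal (2 * X) := by
  rw [ENNReal.tsum_eq_iSup_sum]
  refine iSup_le fun F => ?_
  have hF : ∑ i ∈ F, b i = ∑ i ∈ F.filter (fun i => d i < σ), b i := by
    refine (Finset.sum_filter_of_ne fun i _ hi => ?_).symm
    by_contra h
    exact hi (hb0 i (not_lt.1 h))
  rw [hF]
  rcases (F.filter (fun i => d i < σ)).eq_empty_or_nonempty with h | h
  · rw [h, Finset.sum_empty]; exact zero_le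
  -- Block k has the largest cells among those below σ. It costs X; the others cost C d_k^θ ≤ C σ^θ
  -- ≤ X in total by lacunarity.
  obtain ⟨k, hk, hmax⟩ := Finset.exists_max_image _ d h
  rw [← Finset.add_sum_erase _ _ hk, two_mul, ENNReal.ofReal_add hX hX]
  refine add_le_add (hbX k) ?_
  refine (Finset.sum_le_sum fun i _ => hbw i).trans ?_
  rw [← ENNReal.ofReal_sum_of_nonneg fun i _ => mul_nonneg hC (hw i), ← Finset.mul_sum]
  refine ENNReal.ofReal_le_ofReal (le_trans ?_ hσ)
  refine mul_le_mul_of_nonneg_left ?_ hC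
  refine (hlac k _ fun j hj => ?_).trans
    (Real.rpow_le_rpow (hd0 k).le (Finset.mem_filter.1 hk).2.le hθ)
  obtain ⟨hjk, hj⟩ := Finset.mem_erase.1 hj
  exact lt_of_le_of_ne (hmax j hj) fun h => hjk (hd h)

/-! ### Assembling all blocks, and the left inverse. -/

section Assembly

variable {Ω Y : Type*} [MeasurableSpace Ω] [MeasurableSpace Y] {μ : Measure Ω} {ν : Measure Y}
  {lab : ℕ → Ω → ℕ} {π : Y → ℕ × ℕ} {p : ℝ} {s d : ℕ → ℝ}

/-- Bounded sequences in `WeakLp p μ`, discretized on finer and finer grids and transplanted to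
disjoint blocks of rapidly varying cell sizes, form elements of `WeakLp p ν`. -/
theorem exists_clm_blocks (hp : 1 < p) [SigmaFinite μ] [SigmaFinite ν]
    (hlab : ∀ i, Measurable (lab i)) (hπ : Measurable π) (hs : ∀ i, 0 < s i) (hd0 : ∀ i, 0 < d i)
    (hμ : ∀ i, ∀ j ∈ Finset.range (4 ^ i), μ (lab i ⁻¹' {j}) = ENNReal.ofReal (s i))
    (hν : ∀ i, ∀ j ∈ Finset.range (4 ^ i), ν (π ⁻¹' {(i, j)}) = ENNReal.ofReal (d i))
    (hd : Function.Injective d)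
    (hlac : ∀ (i : ℕ) (F : Finset ℕ), (∀ j ∈ F, d j < d i) →
      ∑ j ∈ F, ((4 : ℝ) ^ j * d j) ^ (1 - 1 / p) ≤ d i ^ (1 - 1 / p)) :
    ∃ A : (ℕ →ᵇ WeakLp p μ) →L[ℝ] WeakLp p ν, ∀ z, (A z).1 =ᵐ[ν] fun y =>
      (s (π y).1 / d (π y).1) ^ (1 / p) * fiberAverage μ (lab (π y).1)
        (Finset.range (4 ^ (π y).1)) (z (π y).1.unpair.2).1 (π y).2 := by
  have hθ := (one_sub_one_div_pos hp).le
  have hi : ∀ (f : WeakLp p μ) (i : ℕ), ∀ j ∈ (Finset.range (4 ^ i) : Set ℕ),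
      IntegrableOn f.1 (lab i ⁻¹' {j}) μ := fun f i j hj =>
    WeakLp.integrableOn hp f (hlab i (measurableSet_singleton j)) (by
      rw [hμ i j (by simpa using hj)]; exact ENNReal.ofReal_lt_top)
  set a : (ℕ →ᵇ WeakLp p μ) → ℕ × ℕ → ℝ := fun z k =>
    (s k.1 / d k.1) ^ (1 / p) * fiberAverage μ (lab k.1)
        (Finset.range (4 ^ k.1)) (z k.1.unpair.2).1 k.2 with ha
  -- The blocks have total excess at most 2 C^p t^{1-p}; the norm criterion with K = 2 C^p gives 2 ·
  -- 2^{1/p} C.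
  obtain ⟨A, hA, -⟩ := WeakLp.exists_clm (p := p) (μ := ν) (K := 2 * 2 ^ (1 / p))
    (fun (z : ℕ →ᵇ WeakLp p μ) y => a z (π y))
    (fun z => ((measurable_of_countable (a z)).comp hπ).aestronglyMeasurable)
    (fun z w => Eq.eventuallyEq <| by
      ext y
      simp only [ha, Pi.add_apply, BoundedContinuousFunction.coe_add]
      rw [fiberAverage_congr (WeakLp.coeFn_add _ _), fiberAverage_add (hi _ _) (hi _ _),
        Pi.add_apply, mul_add])
    (fun c z => Eq.eventuallyEq <| by
      ext y
      simp only [ha, Pi.smul_apply, BoundedContinuousFunction.coe_smul]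
      rw [fiberAverage_congr (WeakLp.coeFn_smul _ _), fiberAverage_smul, Pi.smul_apply,
        smul_eq_mul, smul_eq_mul, mul_left_comm])
    (by positivity)
    (fun z C hC hzC => by
      rw [← rpow_two_mul_rpow hp hC]
      refine weakLpENorm_le_of_lintegral_excess_le hp (by positivity) fun t ht => ?_
      have hz : ∀ i, ‖z i‖ ≤ C := fun i => (z.norm_coe_le_norm i).trans hzC
      rw [lintegral_comp_eq_tsum hπ (fun k => ENNReal.ofReal (|a z k| - t)),
        ENNReal.tsum_prod', mul_assoc]
      calc ∑' i, ∑' j, ENNReal.ofReal (|a z (i, j)| - t) * ν (π ⁻¹' {(i, j)})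
          ≤ ∑' i, ∑' j, ENNReal.ofReal ((s i / d i) ^ (1 / p) * |fiberAverage μ (lab i)
              (Finset.range (4 ^ i)) (z i.unpair.2).1 j| - t) * ENNReal.ofReal (d i) := by
            refine ENNReal.tsum_le_tsum fun i => ENNReal.tsum_le_tsum fun j => ?_
            have hc : 0 ≤ (s i / d i) ^ (1 / p) :=
              Real.rpow_nonneg (div_nonneg (hs i).le (hd0 i).le) _
            simp only [ha, abs_mul, abs_of_nonneg hc]
            by_cases hj : j ∈ Finset.range (4 ^ i)
            · rw [hν i j hj]
            · rw [fiberAverage_of_notMem (by simpa using hj), abs_zero, mul_zero, zero_sub,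
                ENNReal.ofReal_of_nonpos (by linarith)]
              simp
        _ ≤ _ := by
            refine tsum_le_of_lacunary (d := d) (w := fun j => (4 ^ j * d j) ^ (1 - 1 / p))
              (C := C) (σ := (C / t) ^ p) hC.le hθ hd0 hd (fun j => by have := hd0 j; positivity)
              hlac (by positivity)
              (fun i => tsum_excess_transplant_le hp (hlab i) (hs i) (hd0 i) (hμ i) _ hC (hz _) ht)
              (fun i => ?_)
              (fun i hi => tsum_excess_transplant_eq_zero hp (hlab i) (hs i) (hd0 i) (hμ i) _ hC
                (hz _) ht hi) (le_of_eq ?_)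
            · refine (tsum_excess_transplant_le_of_card hp (hlab i) (hs i) (hd0 i) (hμ i) _ hC
                (hz _) ht).trans (le_of_eq ?_)
              simp
            · rw [← Real.rpow_mul (by positivity), show p * (1 - 1 / p) = p - 1 by field_simp,
                Real.div_rpow hC.le ht.le, show (1 - p) = -(p - 1) by ring, Real.rpow_neg ht.le,
                ← div_eq_mul_inv, ← mul_div_assoc]
              congr 1
              nth_rw 1 [← Real.rpow_one C]
              rw [← Real.rpow_add hC]
              congr 1; ring)
  exact ⟨A, hA⟩

/-- Transplanting a single block back. -/
theorem exists_clm_block_inverse (hp : 1 < p) [SigmaFinite μ] [SigmaFinite ν]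
    (hlab : ∀ i, Measurable (lab i)) (hπ : Measurable π) (hs : ∀ i, 0 < s i) (hd0 : ∀ i, 0 < d i)
    (hμ : ∀ i, ∀ j ∈ Finset.range (4 ^ i), μ (lab i ⁻¹' {j}) = ENNReal.ofReal (s i))
    (hν : ∀ i, ∀ j ∈ Finset.range (4 ^ i), ν (π ⁻¹' {(i, j)}) = ENNReal.ofReal (d i)) (i : ℕ) :
    ∃ P : WeakLp p ν →L[ℝ] WeakLp p μ, (∀ x, (P x).1 =ᵐ[μ] fun ω =>
      (d i / s i) ^ (1 / p) * fiberAverage ν π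
        ({i} ×ˢ Finset.range (4 ^ i) : Finset (ℕ × ℕ)) x.1 (i, lab i ω)) ∧
      ∀ x, ‖P x‖ ≤ 2 * ‖x‖ := by
  set J : Finset (ℕ × ℕ) := {i} ×ˢ Finset.range (4 ^ i) with hJdef
  have hJ : ∀ k ∈ J, ν (π ⁻¹' {k}) = ENNReal.ofReal (d i) := by
    rintro ⟨i', j⟩ hk
    obtain ⟨h1, h2⟩ := Finset.mem_product.1 hk
    obtain rfl : i' = i := by simpa using h1
    exact hν i' j h2
  have hi : ∀ (x : WeakLp p ν), ∀ k ∈ (J : Set (ℕ × ℕ)), IntegrableOn x.1 (π ⁻¹' {k}) ν :=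
    fun x k hk => WeakLp.integrableOn hp x (hπ (measurableSet_singleton k)) (by
      rw [hJ k (by simpa using hk)]; exact ENNReal.ofReal_lt_top)
  have hc : 0 ≤ (d i / s i) ^ (1 / p) := Real.rpow_nonneg (div_nonneg (hd0 i).le (hs i).le) _
  set a : WeakLp p ν → ℕ → ℝ := fun x j =>
    (d i / s i) ^ (1 / p) * fiberAverage ν π J x.1 (i, j) with ha
  refine WeakLp.exists_clm (p := p) (μ := μ) (K := 2)
    (fun (x : WeakLp p ν) ω => a x (lab i ω))
    (fun x => ((measurable_of_countable (a x)).comp (hlab i)).aestronglyMeasurable)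
    (fun z w => Eq.eventuallyEq <| by
      ext y
      simp only [ha, Pi.add_apply]
      rw [fiberAverage_congr (WeakLp.coeFn_add _ _), fiberAverage_add (hi _) (hi _),
        Pi.add_apply, mul_add])
    (fun c z => Eq.eventuallyEq <| by
      ext y
      simp only [ha, Pi.smul_apply]
      rw [fiberAverage_congr (WeakLp.coeFn_smul _ _), fiberAverage_smul, Pi.smul_apply,
        smul_eq_mul, smul_eq_mul, mul_left_comm])
    zero_le_two
    (fun x C hC hxC => by
      rw [← two_mul_rpow_rpow hp hC]
      refine weakLpENorm_le_of_lintegral_excess_le hp (by positivity) fun t ht => ?_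
      rw [lintegral_comp_eq_tsum (hlab i) (fun k => ENNReal.ofReal (|a x k| - t))]
      refine le_trans ?_ (tsum_excess_transplant_le hp hπ (hd0 i) (hs i) hJ x hC hxC ht)
      -- The cells of block i are among all cells (i', j), so their sum is part of the full one.
      refine le_trans ?_ (ENNReal.tsum_comp_le_tsum_of_injective
        (f := fun j : ℕ => (i, j)) (fun j j' h => (Prod.ext_iff.1 h).2) _)
      refine ENNReal.tsum_le_tsum fun j => ?_
      simp only [ha, abs_mul, abs_of_nonneg hc]
      by_cases hj : j ∈ Finset.range (4 ^ i)
      · rw [hμ i j hj]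
      · rw [fiberAverage_of_notMem (by simpa [hJdef] using hj), abs_zero, mul_zero, zero_sub,
          ENNReal.ofReal_of_nonpos (by linarith)]
        simp)

/-- Coordinate m of the left inverse is the weak limit, over n, of the blocks pair(n, m) copied
back; these maps have norm at most 2 uniformly in the block. The hypothesis `hconv` isolates what is
needed of the source grids: their averages recover f. -/
theorem isComplementedIn_boundedSeq_of_blocks (hp : 1 < p) [SigmaFinite μ] [SigmaFinite ν]
    (hlab : ∀ i, Measurable (lab i)) (hπ : Measurable π) (hs : ∀ i, 0 < s i) (hd0 : ∀ i, 0 < d i)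
    (hμ : ∀ i, ∀ j ∈ Finset.range (4 ^ i), μ (lab i ⁻¹' {j}) = ENNReal.ofReal (s i))
    (hν : ∀ i, ∀ j ∈ Finset.range (4 ^ i), ν (π ⁻¹' {(i, j)}) = ENNReal.ofReal (d i))
    (hd : Function.Injective d)
    (hlac : ∀ (i : ℕ) (F : Finset ℕ), (∀ j ∈ F, d j < d i) →
      ∑ j ∈ F, ((4 : ℝ) ^ j * d j) ^ (1 - 1 / p) ≤ d i ^ (1 - 1 / p))
    (hconv : ∀ (f g : WeakLp p μ) (F : ℕ → WeakLp p μ) (ι : ℕ → ℕ), Tendsto ι atTop atTop →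
      (∀ n, (F n).1 =ᵐ[μ] fun ω => fiberAverage μ (lab (ι n)) (Finset.range (4 ^ ι n)) f.1
        (lab (ι n) ω)) →
      (∀ B, MeasurableSet B → μ B < ∞ →
        Tendsto (fun n => ∫ x in B, (F n).1 x ∂μ) (hyperfilter ℕ) (𝓝 (∫ x in B, g.1 x ∂μ))) →
      g = f) :
    IsComplementedIn (ℕ →ᵇ WeakLp p μ) (WeakLp p ν) := by
  obtain ⟨A, hA⟩ := exists_clm_blocks hp hlab hπ hs hd0 hμ hν hd hlac
  choose P hP hP' using exists_clm_block_inverse hp hlab hπ hs hd0 hμ hν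
  obtain ⟨T, hT, hT'⟩ := WeakLp.exists_ultrafilterLimit (p := p) (μ := μ) hp (hyperfilter ℕ)
  choose S hS using fun m : ℕ => exists_clm_boundedSeq (fun n => P (Nat.pair n m)) 2
    fun n x => hP' _ x
  obtain ⟨B, hB⟩ := exists_clm_boundedSeq (fun m => T.comp (S m)) 2 fun m x => by
    refine (hT _).trans ((BoundedContinuousFunction.norm_le (by positivity)).2 fun n => ?_)
    exact (congrArg norm (hS m x n)).trans_le (hP' _ _)
  refine ⟨A, B, fun z => ?_⟩
  ext1 m
  rw [hB]
  refine hconv (z m) _ (fun n => P (Nat.pair n m) (A z)) (fun n => Nat.pair n m)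
    -- As n ≤ pair(n, m), the grids used for a fixed m become arbitrarily fine.
    (tendsto_atTop_mono (fun n => Nat.left_le_pair n m) tendsto_id) (fun n => ?_)
    fun C hC hCf => ?_
  · filter_upwards [hP (Nat.pair n m) (A z)] with ω hω
    rw [hω, fiberAverage_congr (hA z)]
    set i := Nat.pair n m with hi
    by_cases hj : lab i ω ∈ Finset.range (4 ^ i)
    · rw [fiberAverage_comp (a := fun k : ℕ × ℕ => (s k.1 / d k.1) ^ (1 / p) *
        fiberAverage μ (lab k.1) (Finset.range (4 ^ k.1)) (z k.1.unpair.2).1 k.2) hπ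
        (by simpa using hj)
        (by rw [hν i _ hj]; simpa using hd0 i) (by rw [hν i _ hj]; exact ENNReal.ofReal_lt_top)]
      -- The two scalings cancel, leaving exactly the average of coordinate m on grid i.
      have h1 : (d i / s i) ^ (1 / p) * (s i / d i) ^ (1 / p) = 1 := by
        have := hs i
        have := hd0 i
        rw [← Real.mul_rpow (by positivity) (by positivity), div_mul_div_cancel₀ (by positivity),
          div_self (by positivity), Real.one_rpow]
      rw [← mul_assoc, h1, one_mul, hi, Nat.unpair_pair]
    · rw [fiberAverage_of_notMem (by simpa using hj), fiberAverage_of_notMem (by simpa using hj),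
        mul_zero]
  · have := hT' (S m (A z)) C hC hCf
    simp only [hS] at this
    exact this

end Assembly

/-! ### Dyadic grids on the half-line. -/

section Dyadic

/-- The index of the dyadic interval of length `2⁻ⁱ` containing `x ≥ 0`. -/
noncomputable def dyadicIndex (i : ℕ) (x : ℝ) : ℕ := ⌊x * 2 ^ i⌋₊

theorem measurable_dyadicIndex (i : ℕ) : Measurable (dyadicIndex i) :=
  Nat.measurable_floor.comp (measurable_id.mul_const _)

theorem dyadicIndex_preimage_inter_Ici (i j : ℕ) :
    dyadicIndex i ⁻¹' {j} ∩ Set.Ici 0 = Set.Ico (j / 2 ^ i : ℝ) ((j + 1) / 2 ^ i) := by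
  ext x
  have h2 : (0 : ℝ) < 2 ^ i := by positivity
  simp only [Set.mem_inter_iff, Set.mem_preimage, Set.mem_singleton_iff, Set.mem_Ici, Set.mem_Ico,
    dyadicIndex, div_le_iff₀ h2, lt_div_iff₀ h2]
  constructor
  · rintro ⟨h, hx⟩
    exact (Nat.floor_eq_iff (by positivity)).1 h
  · rintro ⟨h, h'⟩
    have h0 : 0 ≤ x * 2 ^ i := le_trans (by positivity) h
    exact ⟨(Nat.floor_eq_iff h0).2 ⟨h, h'⟩, nonneg_of_mul_nonneg_left h0 h2⟩

/-- Negative reals are also labelled 0, but they are null for the restricted measure. -/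
theorem volume_restrict_dyadicIndex_preimage (i j : ℕ) :
    volume.restrict (Set.Ici (0 : ℝ)) (dyadicIndex i ⁻¹' {j}) = ENNReal.ofReal ((1 / 2) ^ i) := by
  rw [Measure.restrict_apply (measurable_dyadicIndex i (measurableSet_singleton j)),
    dyadicIndex_preimage_inter_Ici, Real.volume_Ico]
  congr 1
  rw [one_div, inv_pow]
  field_simp
  ring

/-- A function on `[0, ∞)` whose integrals over all initial intervals vanish is zero. -/
theorem ae_eq_of_forall_setIntegral_Iio_eq {p : ℝ} (hp : 1 < p) (f g : weakLpOn p (Set.Ici 0))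
    (h : ∀ x : ℝ, 0 < x → ∫ y in Set.Iio x, g.1 y ∂(volume.restrict (Set.Ici 0))
      = ∫ y in Set.Iio x, f.1 y ∂(volume.restrict (Set.Ici 0))) : g = f := by
  set u : ℝ → ℝ := (Set.Ici (0 : ℝ)).indicator ((g - f).1) with hu
  have hloc : LocallyIntegrable u volume := by
    rw [locallyIntegrable_iff]
    intro k hk
    have h1 := WeakLp.integrableOn hp (g - f) hk.measurableSet
      ((Measure.restrict_apply_le (Set.Ici (0 : ℝ)) k).trans_lt hk.measure_lt_top)
    rw [IntegrableOn, Measure.restrict_comm hk.measurableSet] at h1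
    exact (integrable_indicator_iff measurableSet_Ici).2 h1
  have hint : ∀ x : ℝ, 0 < x → ∫ t in (0 : ℝ)..x, u t = 0 := by
    intro x hx
    have hfin : volume.restrict (Set.Ici (0 : ℝ)) (Set.Iio x) < ∞ := by
      rw [Measure.restrict_apply measurableSet_Iio, Set.inter_comm, Set.Ici_inter_Iio]
      exact measure_Ico_lt_top
    rw [intervalIntegral.integral_of_le hx.le, ← integral_Ico_eq_integral_Ioc,
      ← Set.Ici_inter_Iio, Set.inter_comm, hu]
    have e : ∫ t in Set.Iio x ∩ Set.Ici 0, u t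
        = ∫ t in Set.Iio x, (g - f).1 t ∂(volume.restrict (Set.Ici 0)) := by
      rw [Measure.restrict_restrict measurableSet_Iio]
      exact setIntegral_congr_fun (measurableSet_Iio.inter measurableSet_Ici)
        fun t ht => Set.indicator_of_mem ht.2 _
    rw [← hu, e, integral_congr_ae (ae_restrict_of_ae (WeakLp.coeFn_sub g f))]
    simp only [Pi.sub_apply]
    rw [integral_sub (WeakLp.integrableOn hp g measurableSet_Iio hfin)
      (WeakLp.integrableOn hp f measurableSet_Iio hfin), h x hx, sub_self]
  have hzero : (g - f).1 =ᵐ[volume.restrict (Set.Ici (0 : ℝ))] 0 := by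
    have hIoi : ∀ v : ℝ → ℝ, (∀ᵐ x, x ∈ Set.Ioi (0 : ℝ) → v x = 0) →
        v =ᵐ[volume.restrict (Set.Ici (0 : ℝ))] 0 := by
      intro v hv
      rw [← restrict_Ioi_eq_restrict_Ici]
      exact (ae_restrict_iff' measurableSet_Ioi).2 hv
    refine hIoi _ ?_
    -- Lebesgue differentiation: the primitive of u vanishes for positive arguments, and almost
    -- everywhere its derivative is u.
    filter_upwards [_root_.LocallyIntegrable.ae_hasDerivAt_integral hloc] with x hx hx0
    have h1 := hx 0
    have h2 : HasDerivAt (fun x => ∫ t in (0 : ℝ)..x, u t) 0 x := by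
      refine (hasDerivAt_const x (0 : ℝ)).congr_of_eventuallyEq ?_
      filter_upwards [lt_mem_nhds hx0] with y hy using hint y hy
    have h3 := h1.unique h2
    rwa [hu, Set.indicator_of_mem (Set.mem_Ici.2 (le_of_lt hx0))] at h3
  rw [← sub_eq_zero]
  exact WeakLp.ext_ae (hzero.trans AEEqFun.coeFn_zero.symm)

/-- If dyadic averages of `f` on finer and finer grids converge weakly to `g` along an ultrafilter,
then `g = f`. -/
theorem eq_of_tendsto_setIntegral_dyadic {p : ℝ} (hp : 1 < p) (f g : weakLpOn p (Set.Ici 0))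
    (F : ℕ → weakLpOn p (Set.Ici 0)) (ι : ℕ → ℕ) (hι : Tendsto ι atTop atTop)
    (hF : ∀ n, (F n).1 =ᵐ[volume.restrict (Set.Ici 0)] fun x =>
      fiberAverage (volume.restrict (Set.Ici 0)) (dyadicIndex (ι n)) (Finset.range (4 ^ ι n)) f.1
        (dyadicIndex (ι n) x))
    (hlim : ∀ B, MeasurableSet B → volume.restrict (Set.Ici (0 : ℝ)) B < ∞ →
        Tendsto (fun n => ∫ x in B, (F n).1 x ∂(volume.restrict (Set.Ici 0))) (hyperfilter ℕ)
          (𝓝 (∫ x in B, g.1 x ∂(volume.restrict (Set.Ici 0))))) : g = f := by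
  refine ae_eq_of_forall_setIntegral_Iio_eq hp f g fun x hx => ?_
  set μ : Measure ℝ := volume.restrict (Set.Ici 0) with hμ
  have hθ := one_sub_one_div_pos hp
  have hfib : ∀ i j, MeasurableSet (dyadicIndex i ⁻¹' {j}) := fun i j =>
    measurable_dyadicIndex i (measurableSet_singleton j)
  have hfin : ∀ i j, μ (dyadicIndex i ⁻¹' {j}) < ∞ := fun i j => by
    rw [volume_restrict_dyadicIndex_preimage]; exact ENNReal.ofReal_lt_top
  have hreal : ∀ i j, μ.real (dyadicIndex i ⁻¹' {j}) = (1 / 2) ^ i := fun i j => by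
    rw [measureReal_def, volume_restrict_dyadicIndex_preimage,
      ENNReal.toReal_ofReal (by positivity)]
  have hBf : μ (Set.Iio x) < ∞ := by
    rw [hμ, Measure.restrict_apply measurableSet_Iio, Set.inter_comm, Set.Ici_inter_Iio]
    exact measure_Ico_lt_top
  have hFj : ∀ n j, ∀ᵐ y ∂μ, y ∈ dyadicIndex (ι n) ⁻¹' {j} → (F n).1 y =
      fiberAverage μ (dyadicIndex (ι n)) (Finset.range (4 ^ ι n)) f.1 j := fun n j => by
    filter_upwards [hF n] with y hy hyj
    rw [hy, Set.mem_singleton_iff.1 hyj]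
  have hcell : ∀ n j, j < 4 ^ ι n → ∫ y in dyadicIndex (ι n) ⁻¹' {j}, (F n).1 y ∂μ
      = ∫ y in dyadicIndex (ι n) ⁻¹' {j}, f.1 y ∂μ := by
    intro n j hj
    rw [setIntegral_congr_ae (hfib _ _) (hFj n j), setIntegral_const,
      fiberAverage_of_mem (by simpa using hj), setAverage_eq, smul_smul, mul_inv_cancel₀, one_smul]
    rw [hreal]
    positivity
  have habs : ∀ n j, ∫ y in dyadicIndex (ι n) ⁻¹' {j}, |(F n).1 y| ∂μ
      ≤ ∫ y in dyadicIndex (ι n) ⁻¹' {j}, |f.1 y| ∂μ := by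
    intro n j
    have e : ∫ y in dyadicIndex (ι n) ⁻¹' {j}, |(F n).1 y| ∂μ
        = μ.real (dyadicIndex (ι n) ⁻¹' {j}) *
          |fiberAverage μ (dyadicIndex (ι n)) (Finset.range (4 ^ ι n)) f.1 j| := by
      rw [setIntegral_congr_ae (g := fun _ =>
        |fiberAverage μ (dyadicIndex (ι n)) (Finset.range (4 ^ ι n)) f.1 j|) (hfib _ _),
        setIntegral_const, smul_eq_mul]
      filter_upwards [hFj n j] with y hy hyj
      rw [hy hyj]
    rw [e]
    by_cases hj : j < 4 ^ ι n
    · rw [fiberAverage_of_mem (by simpa using hj), setAverage_eq, smul_eq_mul, abs_mul, abs_inv,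
        abs_of_nonneg measureReal_nonneg, mul_inv_cancel_left₀ (by rw [hreal]; positivity)]
      exact abs_integral_le_integral_abs
    · rw [fiberAverage_of_notMem (by simpa using hj), abs_zero, mul_zero]
      exact integral_nonneg fun _ => abs_nonneg _
  -- The two integrals agree over the cells before the one containing x. Over the remainder, inside
  -- that single cell of length 2^{-i}, each is at most ‖f‖ (2^{-i})^{1-1/p}.
  have hbound : ∀ᶠ n in atTop, |∫ y in Set.Iio x, (F n).1 y ∂μ - ∫ y in Set.Iio x, f.1 y ∂μ|
      ≤ 2 * ‖f‖ * (((1 : ℝ) / 2) ^ ι n) ^ (1 - 1 / p) := by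
    obtain ⟨i₀, hi₀⟩ := pow_unbounded_of_one_lt x (one_lt_two : (1 : ℝ) < 2)
    filter_upwards [hι.eventually_ge_atTop i₀] with n hn
    set i := ι n
    have h2 : (0 : ℝ) < 2 ^ i := by positivity
    set N := dyadicIndex i x with hN
    have hx2 : x ≤ 2 ^ i := hi₀.le.trans (pow_le_pow_right₀ one_le_two hn)
    -- The 4^i cells cover [0, 2^i), so once x ≤ 2^i all cells before that of x are among those
    -- averaged.
    have hN4 : N ≤ 4 ^ i := by
      refine Nat.floor_le_of_le ?_
      push_cast
      calc x * 2 ^ i ≤ 2 ^ i * 2 ^ i := by gcongr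
        _ = 4 ^ i := by rw [← mul_pow]; norm_num
    set S : Set ℝ := ⋃ j ∈ Finset.range N, dyadicIndex i ⁻¹' {j} with hS
    have hmemS : ∀ y, y ∈ S ↔ dyadicIndex i y < N := fun y => by simp [hS]
    have hSm : MeasurableSet S := Finset.measurableSet_biUnion _ fun j _ => hfib i j
    have hSB : S ⊆ Set.Iio x := by
      intro y hy
      by_contra hxy
      have : N ≤ dyadicIndex i y :=
        Nat.floor_le_floor (mul_le_mul_of_nonneg_right (not_lt.1 hxy) h2.le)
      exact absurd ((hmemS y).1 hy) (not_lt.2 this)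
    have hdiff : Set.Iio x \ S ⊆ dyadicIndex i ⁻¹' {N} := by
      rintro y ⟨hy, hyS⟩
      rw [hmemS] at hyS
      have : dyadicIndex i y ≤ N :=
        Nat.floor_le_floor (mul_le_mul_of_nonneg_right (le_of_lt hy) h2.le)
      exact le_antisymm this (not_lt.1 hyS)
    have hSint : ∫ y in S, (F n).1 y ∂μ = ∫ y in S, f.1 y ∂μ := by
      have hd : Set.Pairwise (Finset.range N : Set ℕ)
          (Function.onFun Disjoint fun j => dyadicIndex i ⁻¹' {j}) := fun j _ k _ hjk =>
        Set.disjoint_left.2 fun y hy hy' => hjk (hy.symm.trans hy')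
      rw [hS, integral_biUnion_finset _ (fun j _ => hfib i j) hd
        (fun j _ => WeakLp.integrableOn hp _ (hfib i j) (hfin i j)),
        integral_biUnion_finset _ (fun j _ => hfib i j) hd
        (fun j _ => WeakLp.integrableOn hp _ (hfib i j) (hfin i j))]
      exact Finset.sum_congr rfl fun j hj =>
        hcell n j ((Finset.mem_range.1 hj).trans_le hN4)
    have hcellN : ∫ y in dyadicIndex i ⁻¹' {N}, |f.1 y| ∂μ
        ≤ ‖f‖ * (((1 : ℝ) / 2) ^ i) ^ (1 - 1 / p) := by
      have := WeakLp.setIntegral_abs_le hp f (hfib i N) (hfin i N)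
      rwa [hreal] at this
    have hrest : ∀ v : weakLpOn p (Set.Ici 0), |∫ y in Set.Iio x \ S, v.1 y ∂μ|
        ≤ ∫ y in dyadicIndex i ⁻¹' {N}, |v.1 y| ∂μ := fun v =>
      abs_integral_le_integral_abs.trans (setIntegral_mono_set
        (WeakLp.integrableOn hp v (hfib i N) (hfin i N)).abs
        (Eventually.of_forall fun _ => abs_nonneg _) hdiff.eventuallyLE)
    have hsplit : ∀ v : weakLpOn p (Set.Ici 0), ∫ y in Set.Iio x, v.1 y ∂μ
        = ∫ y in S, v.1 y ∂μ + ∫ y in Set.Iio x \ S, v.1 y ∂μ := fun v => by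
      have := integral_inter_add_sdiff hSm (WeakLp.integrableOn hp v measurableSet_Iio hBf)
      rw [Set.inter_eq_self_of_subset_right hSB] at this
      exact this.symm
    rw [hsplit, hsplit f, hSint, add_sub_add_left_eq_sub]
    refine (abs_sub _ _).trans ?_
    have h1 := (hrest (F n)).trans ((habs n N).trans hcellN)
    have h3 := (hrest f).trans hcellN
    linarith
  have hto : Tendsto (fun n => 2 * ‖f‖ * (((1 : ℝ) / 2) ^ ι n) ^ (1 - 1 / p)) atTop (𝓝 0) := by
    have h1 : Tendsto (fun n => ((1 : ℝ) / 2) ^ ι n) atTop (𝓝 0) :=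
      (tendsto_pow_atTop_nhds_zero_of_lt_one (by norm_num) (by norm_num)).comp hι
    have h2 := (h1.rpow_const (p := 1 - 1 / p) (Or.inr hθ.le)).const_mul (2 * ‖f‖)
    rwa [Real.zero_rpow hθ.ne', mul_zero] at h2
  have hconv : Tendsto (fun n => ∫ y in Set.Iio x, (F n).1 y ∂μ) atTop
      (𝓝 (∫ y in Set.Iio x, f.1 y ∂μ)) := by
    rw [tendsto_iff_dist_tendsto_zero]
    refine squeeze_zero' (Eventually.of_forall fun _ => dist_nonneg) ?_ hto
    simpa only [Real.dist_eq] using hbound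
  exact tendsto_nhds_unique (hlim _ measurableSet_Iio hBf)
    (hconv.mono_left Nat.hyperfilter_le_atTop)

end Dyadic

/-! ### Lacunarity of the cell sizes. -/

section Lacunary

theorem sum_half_pow_le_one (F : Finset ℕ) (r : ℕ → ℕ) (hr : Set.InjOn r F)
    (hr1 : ∀ j ∈ F, 1 ≤ r j) : ∑ j ∈ F, ((1 : ℝ) / 2) ^ r j ≤ 1 := by
  rw [← Finset.sum_image (f := fun n => ((1 : ℝ) / 2) ^ n) hr]
  have h0 : 0 ∉ F.image r := by
    intro h
    obtain ⟨j, hj, hj0⟩ := Finset.mem_image.1 h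
    have := hr1 j hj
    omega
  have h1 := summable_geometric_two.sum_le_tsum (insert 0 (F.image r))
    (fun n _ => by positivity)
  rw [Finset.sum_insert h0, tsum_geometric_two] at h1
  norm_num at h1 ⊢
  linarith

/-- Since Qθ ≥ 1, an exponent gap Q r gains at least a factor 2^{-r} after raising to the power θ.
Distinct ranks r ≥ 1 then give a geometric sum at most 1. -/
theorem sum_rpow_le_of_exponent_gap {θ : ℝ} (hθ : 0 < θ) {Q : ℕ} (hQ : 1 ≤ Q * θ) {e : ℕ → ℤ}
    {r : ℕ → ℕ → ℕ} (hr1 : ∀ i j, e j < e i → 1 ≤ r i j)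
    (hr : ∀ i, Set.InjOn (r i) {j | e j < e i})
    (hgap : ∀ i j, e j < e i → (j : ℤ) + e j + Q * r i j ≤ e i)
    (i : ℕ) (F : Finset ℕ) (hF : ∀ j ∈ F, (4 : ℝ) ^ e j < 4 ^ e i) :
    ∑ j ∈ F, ((4 : ℝ) ^ j * 4 ^ e j) ^ θ ≤ ((4 : ℝ) ^ e i) ^ θ := by
  have hF' : ∀ j ∈ F, e j < e i := fun j hj =>
    (zpow_lt_zpow_iff_right₀ (by norm_num : (1 : ℝ) < 4)).1 (hF j hj)
  have hterm : ∀ j ∈ F, ((4 : ℝ) ^ j * 4 ^ e j) ^ θ ≤ ((4 : ℝ) ^ e i) ^ θ * (1 / 2) ^ r i j := by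
    intro j hj
    have h1 : (4 : ℝ) ^ j * 4 ^ e j ≤ 4 ^ e i * ((4 : ℝ) ^ (Q * r i j))⁻¹ := by
      rw [le_mul_inv_iff₀ (by positivity), ← zpow_natCast, ← zpow_natCast,
        ← zpow_add₀ (by norm_num), ← zpow_add₀ (by norm_num)]
      refine zpow_le_zpow_right₀ (by norm_num) ?_
      have := hgap i j (hF' j hj)
      push_cast
      exact this
    have h2 : (2 : ℝ) ^ r i j ≤ ((4 : ℝ) ^ (Q * r i j)) ^ θ := by
      rw [← Real.rpow_natCast 4, ← Real.rpow_mul (by norm_num), ← Real.rpow_natCast 2]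
      calc (2 : ℝ) ^ (r i j : ℝ) ≤ 4 ^ (r i j : ℝ) :=
            Real.rpow_le_rpow (by norm_num) (by norm_num) (by positivity)
        _ ≤ _ := by
            refine Real.rpow_le_rpow_of_exponent_le (by norm_num) ?_
            push_cast
            have : (0 : ℝ) ≤ r i j := by positivity
            nlinarith
    calc _ ≤ ((4 : ℝ) ^ e i * ((4 : ℝ) ^ (Q * r i j))⁻¹) ^ θ :=
          Real.rpow_le_rpow (by positivity) h1 hθ.le
      _ = ((4 : ℝ) ^ e i) ^ θ * (((4 : ℝ) ^ (Q * r i j)) ^ θ)⁻¹ := by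
          rw [Real.mul_rpow (by positivity) (by positivity), Real.inv_rpow (by positivity)]
      _ ≤ _ := by
          rw [one_div, inv_pow]
          gcongr
  refine (Finset.sum_le_sum hterm).trans ?_
  rw [← Finset.mul_sum]
  refine mul_le_of_le_one_right (by positivity) ?_
  exact sum_half_pow_le_one F (r i) ((hr i).mono fun j hj => hF' j hj)
    fun j hj => hr1 i j (hF' j hj)

theorem sum_rpow_le_increasing {θ : ℝ} (hθ : 0 < θ) {Q : ℕ} (hQ : 1 ≤ Q * θ)
    (i : ℕ) (F : Finset ℕ)
    (hF : ∀ j ∈ F, (4 : ℝ) ^ ((Q : ℤ) * (j + 1) ^ 2) < 4 ^ ((Q : ℤ) * (i + 1) ^ 2)) :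
    ∑ j ∈ F, ((4 : ℝ) ^ j * 4 ^ ((Q : ℤ) * (j + 1) ^ 2)) ^ θ
      ≤ ((4 : ℝ) ^ ((Q : ℤ) * (i + 1) ^ 2)) ^ θ := by
  have hQ1 : 1 ≤ (Q : ℤ) := by
    rcases Nat.eq_zero_or_pos Q with h | h
    · rw [h] at hQ; norm_num at hQ
    · exact_mod_cast h
  have hlt : ∀ i j : ℕ, (Q : ℤ) * (j + 1) ^ 2 < Q * (i + 1) ^ 2 → j < i := by
    intro i j h
    by_contra hij
    have : (i : ℤ) ≤ j := by exact_mod_cast not_lt.1 hij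
    have : ((i : ℤ) + 1) ^ 2 ≤ (j + 1) ^ 2 := by gcongr
    nlinarith
  refine sum_rpow_le_of_exponent_gap hθ hQ (e := fun j => (Q : ℤ) * (j + 1) ^ 2)
    (r := fun i j => i - j) (fun i j h => ?_) (fun i j hj k hk hjk => ?_) (fun i j h => ?_) i F hF
  · have := hlt i j h
    omega
  · have h1 := hlt i j hj
    have h2 := hlt i k hk
    have h3 : i - j = i - k := hjk
    omega
  · obtain ⟨l, rfl⟩ := Nat.exists_eq_add_of_lt (hlt i j h)
    rw [show j + l + 1 - j = l + 1 by omega]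
    push_cast
    have hj : (0 : ℤ) ≤ j := by positivity
    have hl : (0 : ℤ) ≤ l := by positivity
    -- Quadratic exponents leave room for the cardinality 4^j as well as the gap: by `e1` the claim
    -- follows from Q times `e2`.
    have e1 : (j : ℤ) ≤ Q * j := by nlinarith
    have e2 : (j : ℤ) + (j + 1) ^ 2 + (l + 1) ≤ (j + l + 1 + 1) ^ 2 := by nlinarith
    nlinarith

theorem sum_rpow_le_decreasing {θ : ℝ} (hθ : 0 < θ) {Q : ℕ} (hQ : 1 ≤ Q * θ)
    (i : ℕ) (F : Finset ℕ)
    (hF : ∀ j ∈ F, (4 : ℝ) ^ (-((Q : ℤ) * (j + 1) ^ 2)) < 4 ^ (-((Q : ℤ) * (i + 1) ^ 2))) :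
    ∑ j ∈ F, ((4 : ℝ) ^ j * 4 ^ (-((Q : ℤ) * (j + 1) ^ 2))) ^ θ
      ≤ ((4 : ℝ) ^ (-((Q : ℤ) * (i + 1) ^ 2))) ^ θ := by
  have hQ1 : 1 ≤ (Q : ℤ) := by
    rcases Nat.eq_zero_or_pos Q with h | h
    · rw [h] at hQ; norm_num at hQ
    · exact_mod_cast h
  have hlt : ∀ i j : ℕ, -((Q : ℤ) * (j + 1) ^ 2) < -(Q * (i + 1) ^ 2) → i < j := by
    intro i j h
    by_contra hij
    have : (j : ℤ) ≤ i := by exact_mod_cast not_lt.1 hij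
    have : ((j : ℤ) + 1) ^ 2 ≤ (i + 1) ^ 2 := by gcongr
    nlinarith
  refine sum_rpow_le_of_exponent_gap hθ hQ (e := fun j => -((Q : ℤ) * (j + 1) ^ 2))
    (r := fun i j => j - i) (fun i j h => ?_) (fun i j hj k hk hjk => ?_) (fun i j h => ?_) i F hF
  · have := hlt i j h
    omega
  · have h1 := hlt i j hj
    have h2 := hlt i k hk
    have h3 : j - i = k - i := hjk
    omega
  · obtain ⟨l, rfl⟩ := Nat.exists_eq_add_of_lt (hlt i j h)
    rw [show i + l + 1 - i = l + 1 by omega]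
    push_cast
    have hi : (0 : ℤ) ≤ i := by positivity
    have hl : (0 : ℤ) ≤ l := by positivity
    have e1 : (i + l + 1 : ℤ) ≤ Q * (i + l + 1) := by nlinarith
    have e2 : (i + l + 1 : ℤ) + (i + 1) ^ 2 + (l + 1) ≤ (i + l + 1 + 1) ^ 2 := by nlinarith
    nlinarith

end Lacunary

/-! ### Disjoint target cells of prescribed measure. -/

section Labels

/-- `ℕ` splits into a double sequence of finite sets of prescribed positive cardinalities. -/
theorem exists_label_count (N : ℕ × ℕ → ℕ) (hN : ∀ k, 0 < N k) :
    ∃ π : ℕ → ℕ × ℕ, ∀ k, Measure.count (π ⁻¹' {k}) = (N k : ℝ≥0∞) := by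
  have : Infinite (Σ k, Fin (N k)) :=
    Infinite.of_injective (fun k : ℕ × ℕ => (⟨k, ⟨0, hN k⟩⟩ : Σ k, Fin (N k)))
      fun k l h => congrArg Sigma.fst h
  obtain ⟨e⟩ := nonempty_equiv_of_countable (α := ℕ) (β := Σ k, Fin (N k))
  refine ⟨fun n => (e n).1, fun k => ?_⟩
  have hinj : Function.Injective fun a : Fin (N k) => e.symm ⟨k, a⟩ := fun a b hab => by
    simpa using hab
  have h : (fun n => (e n).1) ⁻¹' {k} =
      ((Finset.univ : Finset (Fin (N k))).map ⟨fun a => e.symm ⟨k, a⟩, hinj⟩ : Finset ℕ) := by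
    ext n
    simp only [Set.mem_preimage, Set.mem_singleton_iff, Finset.coe_map, Finset.coe_univ,
      Set.image_univ, Set.mem_range]
    constructor
    · rintro rfl
      exact ⟨(e n).2, e.symm_apply_apply n⟩
    · rintro ⟨a, rfl⟩
      exact congrArg Sigma.fst (e.apply_symm_apply ⟨k, a⟩)
  rw [h, Measure.count_apply_finset]
  simp

/-- `[0, 1]` contains a double sequence of disjoint sets of prescribed measures of sum at most
one. -/
theorem exists_label_Icc (w : ℕ × ℕ → ℝ≥0∞) (hw : ∑' k, w k ≤ 1) (k₀ : ℕ × ℕ) :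
    ∃ π : ℝ → ℕ × ℕ, Measurable π ∧ ∀ k, k ≠ k₀ →
      volume.restrict (Set.Icc (0 : ℝ) 1) (π ⁻¹' {k}) = w k := by
  -- The missing mass is put at k₀ to get a probability measure, which is then realized as the law
  -- of a map on the unit interval. This is why k₀ is excluded.
  set P : Measure (ℕ × ℕ) := Measure.sum (fun k => w k • Measure.dirac k) +
    (1 - ∑' k, w k) • Measure.dirac k₀ with hP
  have hPprob : IsProbabilityMeasure P := ⟨by
    rw [hP, Measure.add_apply, Measure.sum_apply _ MeasurableSet.univ]
    simp [add_tsub_cancel_of_le hw]⟩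
  obtain ⟨f, hf, hfP⟩ := P.exists_measurable_map_eq
  have hval : MeasurePreserving (Subtype.val : unitInterval → ℝ) volume
      (volume.restrict (Set.Icc (0 : ℝ) 1)) :=
    measurePreserving_subtype_coe measurableSet_Icc
  have hπ : Measurable fun x : ℝ => f (Set.projIcc 0 1 zero_le_one x) :=
    hf.comp continuous_projIcc.measurable
  refine ⟨_, hπ, fun k hk => ?_⟩
  rw [← hval.measure_preimage (hπ (measurableSet_singleton k)).nullMeasurableSet]
  have h1 : (Subtype.val : unitInterval → ℝ) ⁻¹'
      ((fun x : ℝ => f (Set.projIcc 0 1 zero_le_one x)) ⁻¹' {k}) = f ⁻¹' {k} := by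
    ext x
    simp
  rw [h1, ← Measure.map_apply hf (measurableSet_singleton k), hfP, hP, Measure.add_apply,
    Measure.sum_apply _ (measurableSet_singleton k), tsum_eq_single k]
  · simp [hk.symm]
  · intro l hl
    simp [hl]

end Labels

/-! ### Choice of the cell sizes and conclusion. -/

theorem exists_nat_one_le_mul {θ : ℝ} (hθ : 0 < θ) : ∃ Q : ℕ, 1 ≤ Q ∧ 1 ≤ Q * θ := by
  obtain ⟨Q, hQ⟩ := exists_nat_ge (1 / θ)
  refine ⟨Q, ?_, ?_⟩
  · have : (0 : ℝ) < Q := lt_of_lt_of_le (by positivity) hQ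
    exact_mod_cast this
  · rwa [div_le_iff₀ hθ] at hQ

theorem injective_mul_succ_sq {Q : ℕ} (hQ : 1 ≤ Q) :
    Function.Injective fun i : ℕ => (Q : ℤ) * (i + 1) ^ 2 := by
  intro i j h
  have h1 : ((i : ℤ) + 1) ^ 2 = (j + 1) ^ 2 :=
    mul_left_cancel₀ (by exact_mod_cast (by omega : Q ≠ 0)) h
  have h2 : (i : ℤ) + 1 = j + 1 :=
    (pow_left_inj₀ (by positivity) (by positivity) two_ne_zero).1 h1
  omega

section Main

variable {p : ℝ}

theorem isComplementedIn_weakSeqLp (hp : 1 < p) :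
    IsComplementedIn (ℕ →ᵇ weakLpOn p (Set.Ici 0)) (weakSeqLp p) := by
  obtain ⟨Q, hQ1, hQ⟩ := exists_nat_one_le_mul (one_sub_one_div_pos hp)
  obtain ⟨π, hπ⟩ := exists_label_count (fun k => 4 ^ (Q * (k.1 + 1) ^ 2)) fun k => by positivity
  -- In ℕ the cells are finite sets, so their sizes are integers and must grow.
  refine isComplementedIn_boundedSeq_of_blocks (lab := dyadicIndex) (π := π)
    (s := fun i => (1 / 2) ^ i) (d := fun i => 4 ^ ((Q : ℤ) * (i + 1) ^ 2)) hp
    measurable_dyadicIndex (measurable_of_countable π) (fun i => by positivity)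
    (fun i => by positivity) (fun i j _ => volume_restrict_dyadicIndex_preimage i j)
    (fun i j _ => ?_) ?_ (sum_rpow_le_increasing (one_sub_one_div_pos hp) hQ)
    (eq_of_tendsto_setIntegral_dyadic hp)
  · rw [hπ, ← ENNReal.ofReal_natCast]
    congr 1
    push_cast
    rw [← zpow_natCast]
    push_cast
    rfl
  · exact (zpow_right_injective₀ (by norm_num) (by norm_num)).comp (injective_mul_succ_sq hQ1)

theorem isComplementedIn_weakLpOn_Icc (hp : 1 < p) :
    IsComplementedIn (ℕ →ᵇ weakLpOn p (Set.Ici 0)) (weakLpOn p (Set.Icc 0 1)) := by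
  obtain ⟨Q, hQ1, hQ⟩ := exists_nat_one_le_mul (one_sub_one_div_pos hp)
  -- In [0, 1] the cells shrink instead, fast enough for the block masses 4^i d_i to sum to at most
  -- 1.
  set d : ℕ → ℝ := fun i => 4 ^ (-((Q : ℤ) * (i + 1) ^ 2)) with hd
  have hd0 : ∀ i, 0 < d i := fun i => by positivity
  have hdle : ∀ i : ℕ, (4 : ℝ) ^ i * d i ≤ (1 / 2) ^ (i + 1) := by
    intro i
    have h1 : (4 : ℝ) ^ i * d i ≤ 4 ^ (-((i : ℤ) + 1)) := by
      rw [hd, ← zpow_natCast, ← zpow_add₀ (by norm_num)]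
      refine zpow_le_zpow_right₀ (by norm_num) ?_
      have hQ1' : (1 : ℤ) ≤ Q := by exact_mod_cast hQ1
      have hi : (0 : ℤ) ≤ i := by positivity
      nlinarith [mul_nonneg (sub_nonneg.2 hQ1') (sq_nonneg ((i : ℤ) + 1))]
    refine h1.trans ?_
    rw [zpow_neg, one_div, inv_pow]
    have h2 : (2 : ℝ) ^ (i + 1) ≤ 4 ^ ((i : ℤ) + 1) := by
      rw [show ((i : ℤ) + 1) = ((i + 1 : ℕ) : ℤ) by push_cast; rfl, zpow_natCast]
      exact pow_le_pow_left₀ (by norm_num) (by norm_num) _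
    gcongr
  set w : ℕ × ℕ → ℝ≥0∞ := fun k =>
    if k.2 ∈ Finset.range (4 ^ k.1) then ENNReal.ofReal (d k.1) else 0 with hw
  have hsum : ∑' k, w k ≤ 1 := by
    rw [ENNReal.tsum_prod']
    calc ∑' i, ∑' j, w (i, j) = ∑' i : ℕ, ENNReal.ofReal (4 ^ i * d i) := by
          refine tsum_congr fun i => ?_
          rw [tsum_eq_sum (s := Finset.range (4 ^ i)) fun j hj => if_neg hj,
            Finset.sum_congr rfl (g := fun _ => ENNReal.ofReal (d i)) fun j hj => if_pos hj,
            Finset.sum_const, Finset.card_range, nsmul_eq_mul, ENNReal.ofReal_mul (by positivity), ENNReal.ofReal_pow (by norm_num)]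
          simp
      _ ≤ ∑' i : ℕ, ENNReal.ofReal ((1 / 2) * (1 / 2) ^ i) := by
          refine ENNReal.tsum_le_tsum fun i => ENNReal.ofReal_le_ofReal ?_
          rw [← pow_succ']
          exact hdle i
      _ = 1 := by
          rw [← ENNReal.ofReal_tsum_of_nonneg (fun i => by positivity)
            (summable_geometric_two.mul_left _), tsum_mul_left, tsum_geometric_two]
          norm_num
  -- Block 0 has the single cell (0, 0), so the label (0, 1) is free to carry the leftover mass.
  obtain ⟨π, hπm, hπ⟩ := exists_label_Icc w hsum (0, 1)
  refine isComplementedIn_boundedSeq_of_blocks (lab := dyadicIndex) (π := π)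
    (s := fun i => (1 / 2) ^ i) (d := d) hp
    measurable_dyadicIndex hπm (fun i => by positivity)
    hd0 (fun i j _ => volume_restrict_dyadicIndex_preimage i j)
    (fun i j hj => ?_) ?_ (sum_rpow_le_decreasing (one_sub_one_div_pos hp) hQ)
    (eq_of_tendsto_setIntegral_dyadic hp)
  · rw [hπ (i, j), hw]
    · exact if_pos hj
    · rintro h
      obtain ⟨rfl, rfl⟩ := Prod.ext_iff.1 h
      simp at hj
  · exact (zpow_right_injective₀ (by norm_num) (by norm_num)).comp
      (neg_injective.comp (injective_mul_succ_sq hQ1))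

theorem weakLpOn_Icc_isComplementedIn_weakLpOn_Ici (hp : 1 < p) :
    IsComplementedIn (weakLpOn p (Set.Icc 0 1)) (weakLpOn p (Set.Ici 0)) := by
  refine isComplementedIn_restrict hp (s := Set.Icc 0 1) measurableSet_Icc ?_
  rw [Measure.restrict_restrict measurableSet_Icc,
    Set.inter_eq_self_of_subset_left Set.Icc_subset_Ici_self]

theorem weakSeqLp_isComplementedIn_weakLpOn_Ici (hp : 1 < p) :
    IsComplementedIn (weakSeqLp p) (weakLpOn p (Set.Ici 0)) := by
  -- Grid 0 consists of unit intervals, so its labels carry Lebesgue measure to counting measure.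
  refine isComplementedIn_of_measurePreserving (π := dyadicIndex 0) hp
    ⟨measurable_dyadicIndex 0, ?_⟩ (fun k => by simp) (fun k => by simp)
  refine Measure.ext_of_singleton fun k => ?_
  rw [Measure.map_apply (measurable_dyadicIndex 0) (measurableSet_singleton k),
    volume_restrict_dyadicIndex_preimage]
  simp

end Main

theorem theorem1 (p : ℝ) (hp : 1 < p) :
    (CompleteSpace (weakSeqLp p) ∧ CompleteSpace (weakLpOn p (Set.Icc 0 1)) ∧
      CompleteSpace (weakLpOn p (Set.Ici 0))) ∧
    Nonempty (weakSeqLp p ≃L[ℝ] weakLpOn p (Set.Icc 0 1)) ∧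
    Nonempty (weakLpOn p (Set.Icc 0 1) ≃L[ℝ] weakLpOn p (Set.Ici 0)) ∧
    Nonempty (weakSeqLp p ≃L[ℝ] weakLpOn p (Set.Ici 0)) := by
  have hZ := nonempty_boundedSeq_boundedSeq (weakLpOn p (Set.Ici 0))
  have hL : IsComplementedIn (weakLpOn p (Set.Ici 0)) (ℕ →ᵇ weakLpOn p (Set.Ici 0)) :=
    isComplementedIn_boundedSeq
  have hI := weakLpOn_Icc_isComplementedIn_weakLpOn_Ici hp
  have hI' := isComplementedIn_weakLpOn_Icc hp
  obtain ⟨a⟩ := nonempty_equiv_of_isComplementedIn hZ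
    ((weakSeqLp_isComplementedIn_weakLpOn_Ici hp).trans hL) (isComplementedIn_weakSeqLp hp)
  obtain ⟨b⟩ := nonempty_equiv_of_isComplementedIn hZ (hI.trans hL) hI'
  -- Z lies complemented in L^{p,∞}[0,∞) by way of L^{p,∞}[0,1].
  obtain ⟨c⟩ := nonempty_equiv_of_isComplementedIn hZ hL (hI'.trans hI)
  exact ⟨⟨WeakLp.completeSpace hp, WeakLp.completeSpace hp, WeakLp.completeSpace hp⟩,
    ⟨a.trans b.symm⟩, ⟨b.trans c.symm⟩, ⟨a.trans c.symm⟩⟩
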